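/- All algebras are associative, unital $\mathbb{C}$-algebras. Let $H$ be a Hopf algebra over $\mathbb{C}$ with comultiplication $\Delta$ and counit $\varepsilon$ (not assumed cocommutative), and let $A$ be an $H$-module algebra, i.e. an algebra with a left $H$-module structure such that $h\cdot(ab)=\sum (h_{(1)}\cdot a)(h_{(2)}\cdot b)$ and $h\cdot 1=\varepsilon(h)1$. Let $A\# H$ be the smash product: the vector space $A\otimes H$ with the multiplication $$(a\otimes h)(a'\otimes h')=\sum a\,(h_{(1)}\cdot a')\otimes h_{(2)}h'.$$ For an algebra $B$, the Arens--Michael envelope $\widehat{B}$ is the (Hausdorff) completion of $B$ with respect to the family of all submultiplicative seminorms on $B$. The $H$-completion $\widetilde{A}$ is the (Hausdorff) completion of $A$ with respect to the family of all submultiplicative seminorms $\|\cdot\|$ on $A$ that are $H$-stable, i.e. such that for each $h\in H$ there is $C>0$ with $\|h\cdot a\|\le C\|a\|$ for all $a\in A$. Write $\widehat{\otimes}$ for the completed projective tensor product of locally convex spaces. The comultiplication of $H$ and the action of $H$ on $A$ extend by continuity to $\widehat{\Delta}\colon\widehat{H}\to\widehat{H}\,\widehat{\otimes}\,\widehat{H}$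 and $\widehat{H}\,\widehat{\otimes}\,\widetilde{A}\to\widetilde{A}$. The analytic smash product $\widetilde{A}\,\widehat{\#}\,\widehat{H}$ is the space $\widetilde{A}\,\widehat{\otimes}\,\widehat{H}$ with the multiplication $$(\mu_{\widetilde{A}}\,\widehat{\otimes}\,\mu_{\widehat{H}})\circ(\mathrm{id}_{\widetilde{A}}\,\widehat{\otimes}\,\tau\,\widehat{\otimes}\,\mathrm{id}_{\widehat{H}}),$$ where $\mu$ denotes multiplication and $\tau\colon\widehat{H}\,\widehat{\otimes}\,\widetilde{A}\to\widetilde{A}\,\widehat{\otimes}\,\widehat{H}$ is the composition of $\widehat{\Delta}\,\widehat{\otimes}\,\mathrm{id}$, the flip of the last two tensor factors, and the action on the first two tensor factors (so that $\tau(h\otimes a)=\sum h_{(1)}\cdot a\otimes h_{(2)}$ for $h\in H$, $a\in A$); this is a complete Hausdorff locally convex algebra with jointly continuous multiplication. Then the canonical map $A\# H\to\widetilde{A}\,\widehat{\#}\,\widehat{H}$, $a\otimes h\mapsto a\otimes h$, extends to an isomorphism of topological algebras $$(A\# H)^{\widehat{\ }}\;\cong\;\widetilde{A}\,\widehat{\#}\,\widehat{H},$$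 that is, there is an algebra isomorphism $\Phi\colon (A\# H)^{\widehat{\ }}\to\widetilde{A}\,\widehat{\#}\,\widehat{H}$ which is a homeomorphism and whose composition with the canonical homomorphism $A\# H\to(A\# H)^{\widehat{\ }}$ is the canonical map. -/

import Mathlib

open UniformSpace Filter
open scoped TensorProduct Topology NNReal

noncomputable section

namespace ArensMichael

/-! ### Locally convex topologies given by families of seminorms, and completions -/

section SeminormTop

variable {E : Type*} [AddCommGroup E] [Module ℂ E]

/-- The vector space `E`, endowed with the locally convex topology (and the uniform structure)
generated by the family `P` of seminorms. -/
def SeminormTop (_P : Set (Seminorm ℂ E)) : Type _ := E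

variable (P : Set (Seminorm ℂ E))

instance : AddCommGroup (SeminormTop P) := inferInstanceAs (AddCommGroup E)

instance : Module ℂ (SeminormTop P) := inferInstanceAs (Module ℂ E)

/-- The identity map `E → SeminormTop P`. -/
def toSeminormTop : E ≃ₗ[ℂ] SeminormTop P := LinearEquiv.refl ℂ E

/-- A member of `P`, viewed as a seminorm on `SeminormTop P`. -/
def SeminormTop.seminorm (p : P) : Seminorm ℂ (SeminormTop P) :=
  p.1.comp (toSeminormTop P).symm.toLinearMap

instance : UniformSpace (SeminormTop P) :=
  ⨅ p : P, (SeminormTop.seminorm P p).toSeminormedAddCommGroup.toUniformSpace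

instance : IsUniformAddGroup (SeminormTop P) :=
  isUniformAddGroup_iInf fun _ => inferInstance

theorem SeminormTop.withSeminorms : WithSeminorms (SeminormTop.seminorm P) :=
  (SeminormFamily.withSeminorms_iff_uniformSpace_eq_iInf (SeminormTop.seminorm P)).2 rfl

instance : PolynormableSpace ℂ (SeminormTop P) :=
  (SeminormTop.withSeminorms P).toPolynormableSpace

instance : ContinuousSMul ℂ (SeminormTop P) := (SeminormTop.withSeminorms P).continuousSMul

instance : UniformContinuousConstSMul ℂ (SeminormTop P) :=
  uniformContinuousConstSMul_of_continuousConstSMul _ _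

/-- The (Hausdorff) completion of `E` with respect to the family `P` of seminorms. -/
abbrev SeminormCompletion : Type _ := Completion (SeminormTop P)

end SeminormTop

section CompletionOfLCS

variable (E : Type*) [AddCommGroup E] [Module ℂ E] [UniformSpace E] [IsUniformAddGroup E]
  [UniformContinuousConstSMul ℂ E]

/-- The canonical map of `E` to its completion. -/
def toComplL : E →L[ℂ] Completion E where
  toFun x := (x : Completion E)
  map_add' := Completion.coe_add
  map_smul' := Completion.coe_smul
  cont := Completion.continuous_coe E

variable {E}

@[simp]
theorem toComplL_apply (x : E) : toComplL E x = (x : Completion E) := rfl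

/-- The canonical linear map of `F` to its completion with respect to the family `P`. -/
def embed {F : Type*} [AddCommGroup F] [Module ℂ F] (P : Set (Seminorm ℂ F)) :
    F →ₗ[ℂ] SeminormCompletion P :=
  (toComplL (SeminormTop P)).toLinearMap ∘ₗ (toSeminormTop P).toLinearMap

theorem denseRange_embed {F : Type*} [AddCommGroup F] [Module ℂ F] (P : Set (Seminorm ℂ F)) :
    DenseRange (embed P) :=
  Completion.denseRange_coe (α := SeminormTop P)

theorem uniformContinuous_seminorm {p : Seminorm ℂ E} (hp : Continuous p) :
    UniformContinuous p :=
  Seminorm.uniformContinuous_of_continuousAt_zero hp.continuousAt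

/-- The continuous extension of a continuous seminorm to the completion. -/
def completionSeminorm (p : Seminorm ℂ E) (hp : Continuous p) : Seminorm ℂ (Completion E) :=
  Seminorm.of (Completion.extension p)
    (fun x y => by
      induction x, y using Completion.induction_on₂ with
      | hp =>
        exact isClosed_le (Completion.continuous_extension.comp continuous_add)
          ((Completion.continuous_extension.comp continuous_fst).add
            (Completion.continuous_extension.comp continuous_snd))
      | ih x y =>
        rw [← Completion.coe_add]
        simp only [Completion.extension_coe (uniformContinuous_seminorm hp)]
        exact map_add_le_add p x y)
    (fun c x => by
      induction x using Completion.induction_on with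
      | hp =>
        exact isClosed_eq (Completion.continuous_extension.comp (continuous_const_smul c))
          (continuous_const.mul Completion.continuous_extension)
      | ih x =>
        rw [← Completion.coe_smul]
        simp only [Completion.extension_coe (uniformContinuous_seminorm hp)]
        exact map_smul_eq_mul p c x)

theorem completionSeminorm_coe (p : Seminorm ℂ E) (hp : Continuous p) (x : E) :
    completionSeminorm p hp (x : Completion E) = p x :=
  Completion.extension_coe (uniformContinuous_seminorm hp) x

theorem continuous_completionSeminorm (p : Seminorm ℂ E) (hp : Continuous p) :
    Continuous (completionSeminorm p hp) :=
  Completion.continuous_extension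

theorem exists_seminorm_ball_subset [PolynormableSpace ℂ E] {U : Set E} (hU : U ∈ 𝓝 (0 : E)) :
    ∃ p : Seminorm ℂ E, Continuous p ∧ ∃ r > 0, p.ball 0 r ⊆ U := by
  obtain ⟨s, r, hr, h⟩ := ((PolynormableSpace.withSeminorms ℂ E).mem_nhds_iff 0 U).1 hU
  exact ⟨_, Seminorm.continuous_finsetSup fun i _ => i.2, r, hr, h⟩

theorem withSeminorms_completion [PolynormableSpace ℂ E] :
    WithSeminorms (fun p : {p : Seminorm ℂ E // Continuous p} => completionSeminorm p.1 p.2) := by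
  rw [SeminormFamily.withSeminorms_iff_nhds_eq_iInf]
  refine le_antisymm ?_ ?_
  · refine le_iInf fun p => ?_
    rw [← tendsto_iff_comap]
    exact (continuous_completionSeminorm p.1 p.2).tendsto' 0 0 (map_zero _)
  · intro U hU
    obtain ⟨V, hV, hVc, hVU⟩ := exists_mem_nhds_isClosed_subset hU
    have hV' : ((↑) : E → Completion E) ⁻¹' V ∈ 𝓝 (0 : E) :=
      (Completion.continuous_coe E).continuousAt.preimage_mem_nhds
        (by rwa [Completion.coe_zero])
    obtain ⟨p, hp, r, hr, hpr⟩ := exists_seminorm_ball_subset hV'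
    refine mem_of_superset (mem_iInf_of_mem ⟨p, hp⟩ ⟨Set.Iio r, Iio_mem_nhds hr, subset_rfl⟩) ?_
    refine Set.Subset.trans ?_ hVU
    intro x hx
    have hopen : IsOpen (completionSeminorm p hp ⁻¹' Set.Iio r) :=
      isOpen_Iio.preimage (continuous_completionSeminorm p hp)
    have hx' := (Completion.denseRange_coe (α := E)).open_subset_closure_inter hopen hx
    refine closure_minimal ?_ hVc hx'
    rintro _ ⟨hy, y, rfl⟩
    refine hpr ?_
    rw [Seminorm.mem_ball_zero, ← completionSeminorm_coe p hp]
    exact hy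

instance [PolynormableSpace ℂ E] : PolynormableSpace ℂ (Completion E) :=
  withSeminorms_completion.toPolynormableSpace

instance [PolynormableSpace ℂ E] : ContinuousSMul ℂ (Completion E) :=
  withSeminorms_completion.continuousSMul

end CompletionOfLCS

section Bilinear

variable {E F G : Type*}
  [AddCommGroup E] [Module ℂ E] [UniformSpace E] [IsUniformAddGroup E]
  [UniformContinuousConstSMul ℂ E]
  [AddCommGroup F] [Module ℂ F] [UniformSpace F] [IsUniformAddGroup F]
  [UniformContinuousConstSMul ℂ F]
  [AddCommGroup G] [Module ℂ G] [UniformSpace G] [IsUniformAddGroup G]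
  [UniformContinuousConstSMul ℂ G]

theorem continuous_bilin_of_bound {ι : Type*} {g : SeminormFamily ℂ G ι} (hg : WithSeminorms g)
    (b : E →ₗ[ℂ] F →ₗ[ℂ] G)
    (h : ∀ i, ∃ p : Seminorm ℂ E, Continuous p ∧ ∃ q : Seminorm ℂ F, Continuous q ∧
      ∀ x y, g i (b x y) ≤ p x * q y) :
    Continuous fun z : E × F => b z.1 z.2 := by
  rw [continuous_iff_continuousAt]
  rintro ⟨x₀, y₀⟩
  rw [ContinuousAt, hg.tendsto_nhds]
  intro i ε hε
  obtain ⟨p, hp, q, hq, hpq⟩ := h i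
  have hc : Continuous fun z : E × F =>
      p (z.1 - x₀) * q (z.2 - y₀) + p (z.1 - x₀) * q y₀ + p x₀ * q (z.2 - y₀) := by
    have h1 : Continuous fun z : E × F => p (z.1 - x₀) :=
      hp.comp (continuous_fst.sub continuous_const)
    have h2 : Continuous fun z : E × F => q (z.2 - y₀) :=
      hq.comp (continuous_snd.sub continuous_const)
    exact ((h1.mul h2).add (h1.mul continuous_const)).add (continuous_const.mul h2)
  have ht := hc.tendsto (x₀, y₀)
  simp only [sub_self, map_zero, zero_mul, mul_zero, add_zero] at ht
  filter_upwards [ht.eventually_lt_const hε] with z hz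
  refine lt_of_le_of_lt ?_ hz
  have key : b z.1 z.2 - b x₀ y₀
      = b (z.1 - x₀) (z.2 - y₀) + b (z.1 - x₀) y₀ + b x₀ (z.2 - y₀) := by
    simp only [map_sub, LinearMap.sub_apply]; abel
  rw [key]
  refine (map_add_le_add _ _ _).trans (add_le_add ((map_add_le_add _ _ _).trans
    (add_le_add (hpq _ _) (hpq _ _))) (hpq _ _))

theorem exists_bound_of_continuous_bilin [PolynormableSpace ℂ E] [PolynormableSpace ℂ F]
    (b : E →ₗ[ℂ] F →ₗ[ℂ] G) (hb : Continuous fun z : E × F => b z.1 z.2)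
    {r : Seminorm ℂ G} (hr : Continuous r) :
    ∃ p : Seminorm ℂ E, Continuous p ∧ ∃ q : Seminorm ℂ F, Continuous q ∧
      ∀ x y, r (b x y) ≤ p x * q y := by
  have ht : Tendsto (fun z : E × F => r (b z.1 z.2)) (𝓝 (0, 0)) (𝓝 0) :=
    (hr.comp hb).tendsto' _ _ (by simp)
  have h1 := ht.eventually_lt_const one_pos
  rw [nhds_prod_eq] at h1
  obtain ⟨U, hU, V, hV, hUV⟩ := mem_prod_iff.1 h1
  obtain ⟨p, hp, s, hs, hpU⟩ := exists_seminorm_ball_subset hU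
  obtain ⟨q, hq, t, ht, hqV⟩ := exists_seminorm_ball_subset hV
  have key : ∀ x y, p x < s → q y < t → r (b x y) < 1 := fun x y hx hy =>
    hUV (Set.mk_mem_prod (hpU ((Seminorm.mem_ball_zero p).2 hx))
      (hqV ((Seminorm.mem_ball_zero q).2 hy)))
  have hs' : Continuous ((s⁻¹).toNNReal • p) := hp.const_smul (s⁻¹).toNNReal
  have ht' : Continuous ((t⁻¹).toNNReal • q) := hq.const_smul (t⁻¹).toNNReal
  refine ⟨_, hs', _, ht', fun x y => ?_⟩
  simp only [smul_apply, NNReal.smul_def, smul_eq_mul,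
    Real.coe_toNNReal _ (inv_pos.2 hs).le, Real.coe_toNNReal _ (inv_pos.2 ht).le]
  have hlim : Tendsto (fun ε : ℝ => (s⁻¹ * p x + ε) * (t⁻¹ * q y + ε)) (𝓝[>] 0)
      (𝓝 ((s⁻¹ * p x) * (t⁻¹ * q y))) := by
    have : Continuous fun ε : ℝ => (s⁻¹ * p x + ε) * (t⁻¹ * q y + ε) := by fun_prop
    exact (this.tendsto' 0 _ (by simp)).mono_left nhdsWithin_le_nhds
  refine ge_of_tendsto hlim ?_
  filter_upwards [self_mem_nhdsWithin] with ε hε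
  have hε : 0 < ε := hε
  have hpx := apply_nonneg p x
  have hqy := apply_nonneg q y
  set α := s⁻¹ * p x + ε with hα
  set β := t⁻¹ * q y + ε with hβ
  have hα0 : 0 < α := by positivity
  have hβ0 : 0 < β := by positivity
  have h2 := key ((α⁻¹ : ℂ) • x) ((β⁻¹ : ℂ) • y)
    (by
      rw [map_smul_eq_mul, norm_inv, Complex.norm_real, Real.norm_of_nonneg hα0.le,
        inv_mul_lt_iff₀ hα0, hα, add_mul, mul_assoc, mul_comm (p x), ← mul_assoc,
        inv_mul_cancel₀ hs.ne', one_mul]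
      exact lt_add_of_pos_right _ (mul_pos hε hs))
    (by
      rw [map_smul_eq_mul, norm_inv, Complex.norm_real, Real.norm_of_nonneg hβ0.le,
        inv_mul_lt_iff₀ hβ0, hβ, add_mul, mul_assoc, mul_comm (q y), ← mul_assoc,
        inv_mul_cancel₀ ht.ne', one_mul]
      exact lt_add_of_pos_right _ (mul_pos hε ht))
  simp only [map_smul, LinearMap.smul_apply, map_smul_eq_mul, norm_inv, Complex.norm_real,
    Real.norm_of_nonneg hα0.le, Real.norm_of_nonneg hβ0.le] at h2
  rw [inv_mul_lt_iff₀ hβ0, inv_mul_lt_iff₀ hα0] at h2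
  linarith [mul_comm α β]

section extend

variable [T0Space G] [CompleteSpace G]

/-- The underlying function of `extendBilin`. -/
def extendBilinFun (b : E →ₗ[ℂ] F →ₗ[ℂ] G) (z : Completion E × Completion F) : G :=
  ((Completion.isDenseInducing_toCompl E).prodMap
    (Completion.isDenseInducing_toCompl F)).extend (fun z : E × F => b z.1 z.2) z

theorem extendBilinFun_coe (b : E →ₗ[ℂ] F →ₗ[ℂ] G)
    (hb : Continuous fun z : E × F => b z.1 z.2) (x : E) (y : F) :
    extendBilinFun b ((x : Completion E), (y : Completion F)) = b x y :=
  IsDenseInducing.extend_eq ((Completion.isDenseInducing_toCompl E).prodMap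
    (Completion.isDenseInducing_toCompl F)) hb (x, y)

/-- A bilinear map as a biadditive map. -/
def bilinToAddHom (b : E →ₗ[ℂ] F →ₗ[ℂ] G) : E →+ F →+ G :=
  AddMonoidHom.mk' (fun x => (b x).toAddMonoidHom) (fun x y => by ext z; simp)

theorem continuous_extendBilinFun (b : E →ₗ[ℂ] F →ₗ[ℂ] G)
    (hb : Continuous fun z : E × F => b z.1 z.2) : Continuous (extendBilinFun b) := by
  have hb' : Continuous fun z : E × F => bilinToAddHom b z.1 z.2 := hb
  have h := (Completion.isDenseInducing_toCompl E).extend_Z_bilin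
    (Completion.isDenseInducing_toCompl F) hb'
  exact h

theorem continuous_extendBilinFun_comp {X : Type*} [TopologicalSpace X]
    (b : E →ₗ[ℂ] F →ₗ[ℂ] G)
    (hb : Continuous fun z : E × F => b z.1 z.2) {f : X → Completion E} {g : X → Completion F}
    (hf : Continuous f) (hg : Continuous g) :
    Continuous fun x => extendBilinFun b (f x, g x) :=
  (continuous_extendBilinFun b hb).comp (hf.prodMk hg)

theorem extendBilinFun_add_left (b : E →ₗ[ℂ] F →ₗ[ℂ] G)
    (hb : Continuous fun z : E × F => b z.1 z.2) (x x' : Completion E) (y : Completion F) :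
    extendBilinFun b (x + x', y) = extendBilinFun b (x, y) + extendBilinFun b (x', y) := by
  induction x, x', y using Completion.induction_on₃ with
  | hp =>
    exact isClosed_eq
      (continuous_extendBilinFun_comp b hb (continuous_fst.add (continuous_fst.comp continuous_snd))
        (continuous_snd.comp continuous_snd))
      ((continuous_extendBilinFun_comp b hb continuous_fst (continuous_snd.comp continuous_snd)).add
        (continuous_extendBilinFun_comp b hb (continuous_fst.comp continuous_snd)
          (continuous_snd.comp continuous_snd)))
  | ih x x' y =>
    rw [← Completion.coe_add, extendBilinFun_coe b hb, extendBilinFun_coe b hb,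
      extendBilinFun_coe b hb, map_add, LinearMap.add_apply]

theorem extendBilinFun_add_right (b : E →ₗ[ℂ] F →ₗ[ℂ] G)
    (hb : Continuous fun z : E × F => b z.1 z.2) (x : Completion E) (y y' : Completion F) :
    extendBilinFun b (x, y + y') = extendBilinFun b (x, y) + extendBilinFun b (x, y') := by
  induction x, y, y' using Completion.induction_on₃ with
  | hp =>
    exact isClosed_eq
      (continuous_extendBilinFun_comp b hb continuous_fst
        ((continuous_fst.comp continuous_snd).add (continuous_snd.comp continuous_snd)))
      ((continuous_extendBilinFun_comp b hb continuous_fst (continuous_fst.comp continuous_snd)).add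
        (continuous_extendBilinFun_comp b hb continuous_fst (continuous_snd.comp continuous_snd)))
  | ih x y y' =>
    rw [← Completion.coe_add, extendBilinFun_coe b hb, extendBilinFun_coe b hb,
      extendBilinFun_coe b hb, map_add]

theorem extendBilinFun_smul_left (b : E →ₗ[ℂ] F →ₗ[ℂ] G)
    (hb : Continuous fun z : E × F => b z.1 z.2) (c : ℂ) (x : Completion E) (y : Completion F) :
    extendBilinFun b (c • x, y) = c • extendBilinFun b (x, y) := by
  induction x, y using Completion.induction_on₂ with
  | hp =>
    exact isClosed_eq
      (continuous_extendBilinFun_comp b hb (continuous_fst.const_smul c) continuous_snd)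
      ((continuous_extendBilinFun b hb).const_smul c)
  | ih x y =>
    rw [← Completion.coe_smul, extendBilinFun_coe b hb, extendBilinFun_coe b hb, map_smul,
      LinearMap.smul_apply]

theorem extendBilinFun_smul_right (b : E →ₗ[ℂ] F →ₗ[ℂ] G)
    (hb : Continuous fun z : E × F => b z.1 z.2) (c : ℂ) (x : Completion E) (y : Completion F) :
    extendBilinFun b (x, c • y) = c • extendBilinFun b (x, y) := by
  induction x, y using Completion.induction_on₂ with
  | hp =>
    exact isClosed_eq
      (continuous_extendBilinFun_comp b hb continuous_fst (continuous_snd.const_smul c))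
      ((continuous_extendBilinFun b hb).const_smul c)
  | ih x y =>
    rw [← Completion.coe_smul, extendBilinFun_coe b hb, extendBilinFun_coe b hb, map_smul]

/-- The continuous extension of a jointly continuous bilinear map to the completions. -/
def extendBilin (b : E →ₗ[ℂ] F →ₗ[ℂ] G) (hb : Continuous fun z : E × F => b z.1 z.2) :
    Completion E →ₗ[ℂ] Completion F →ₗ[ℂ] G :=
  LinearMap.mk₂ ℂ (fun x y => extendBilinFun b (x, y))
    (extendBilinFun_add_left b hb) (extendBilinFun_smul_left b hb)
    (extendBilinFun_add_right b hb) (extendBilinFun_smul_right b hb)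

theorem extendBilin_coe (b : E →ₗ[ℂ] F →ₗ[ℂ] G) (hb : Continuous fun z : E × F => b z.1 z.2)
    (x : E) (y : F) :
    extendBilin b hb (x : Completion E) (y : Completion F) = b x y :=
  extendBilinFun_coe b hb x y

theorem continuous_extendBilin (b : E →ₗ[ℂ] F →ₗ[ℂ] G)
    (hb : Continuous fun z : E × F => b z.1 z.2) :
    Continuous fun z : Completion E × Completion F => extendBilin b hb z.1 z.2 :=
  continuous_extendBilinFun b hb

end extend

end Bilinear

/-! ### The completed projective tensor product -/

section ProjectiveSeminorm

variable {E F : Type*} [AddCommGroup E] [Module ℂ E] [AddCommGroup F] [Module ℂ F]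

/-- The set of the numbers `∑ p(xᵢ) q(yᵢ)` over all representations `u = ∑ xᵢ ⊗ yᵢ`. -/
def projValues (p : Seminorm ℂ E) (q : Seminorm ℂ F) (u : E ⊗[ℂ] F) : Set ℝ :=
  {c | ∃ l : List (E × F), (l.map fun z => z.1 ⊗ₜ[ℂ] z.2).sum = u ∧
    (l.map fun z => p z.1 * q z.2).sum = c}

theorem projValues_nonneg (p : Seminorm ℂ E) (q : Seminorm ℂ F) {u : E ⊗[ℂ] F} {c : ℝ}
    (hc : c ∈ projValues p q u) : 0 ≤ c := by
  obtain ⟨l, -, rfl⟩ := hc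
  refine List.sum_nonneg fun c hc => ?_
  obtain ⟨z, -, rfl⟩ := List.mem_map.1 hc
  exact mul_nonneg (apply_nonneg p _) (apply_nonneg q _)

theorem projValues_bddBelow (p : Seminorm ℂ E) (q : Seminorm ℂ F) (u : E ⊗[ℂ] F) :
    BddBelow (projValues p q u) :=
  ⟨0, fun _ hc => projValues_nonneg p q hc⟩

theorem projValues_tmul (p : Seminorm ℂ E) (q : Seminorm ℂ F) (x : E) (y : F) :
    p x * q y ∈ projValues p q (x ⊗ₜ[ℂ] y) :=
  ⟨[(x, y)], by simp, by simp⟩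

theorem projValues_add (p : Seminorm ℂ E) (q : Seminorm ℂ F) {u v : E ⊗[ℂ] F} {c d : ℝ}
    (hc : c ∈ projValues p q u) (hd : d ∈ projValues p q v) :
    c + d ∈ projValues p q (u + v) := by
  obtain ⟨l, rfl, rfl⟩ := hc
  obtain ⟨m, rfl, rfl⟩ := hd
  exact ⟨l ++ m, by simp, by simp⟩

theorem projValues_smul (p : Seminorm ℂ E) (q : Seminorm ℂ F) (a : ℂ) {u : E ⊗[ℂ] F} {c : ℝ}
    (hc : c ∈ projValues p q u) : ‖a‖ * c ∈ projValues p q (a • u) := by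
  obtain ⟨l, rfl, rfl⟩ := hc
  refine ⟨l.map fun z => (a • z.1, z.2), ?_, ?_⟩
  · rw [List.smul_sum]; simp [Function.comp_def, TensorProduct.smul_tmul']
  · rw [← List.sum_map_mul_left]
    simp [Function.comp_def, map_smul_eq_mul, mul_assoc]

theorem projValues_nonempty (p : Seminorm ℂ E) (q : Seminorm ℂ F) (u : E ⊗[ℂ] F) :
    (projValues p q u).Nonempty := by
  induction u using TensorProduct.induction_on with
  | zero => exact ⟨0, [], by simp, by simp⟩
  | tmul x y => exact ⟨_, projValues_tmul p q x y⟩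
  | add u v hu hv =>
    obtain ⟨c, hc⟩ := hu
    obtain ⟨d, hd⟩ := hv
    exact ⟨_, projValues_add p q hc hd⟩

/-- The projective tensor product of two seminorms:
`(p ⊗ q)(u) = inf {∑ p(xᵢ) q(yᵢ) : u = ∑ xᵢ ⊗ yᵢ}`. -/
def projSeminorm (p : Seminorm ℂ E) (q : Seminorm ℂ F) : Seminorm ℂ (E ⊗[ℂ] F) :=
  Seminorm.ofSMulLE (fun u => sInf (projValues p q u))
    (le_antisymm
      (csInf_le (projValues_bddBelow p q 0) ⟨[], by simp, by simp⟩)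
      (le_csInf (projValues_nonempty p q 0) fun _ hc => projValues_nonneg p q hc))
    (fun u v => by
      refine le_of_forall_pos_le_add fun ε hε => ?_
      obtain ⟨c, hc, hc'⟩ := exists_lt_of_csInf_lt (projValues_nonempty p q u)
        (lt_add_of_pos_right _ (half_pos hε))
      obtain ⟨d, hd, hd'⟩ := exists_lt_of_csInf_lt (projValues_nonempty p q v)
        (lt_add_of_pos_right _ (half_pos hε))
      have := csInf_le (projValues_bddBelow p q (u + v)) (projValues_add p q hc hd)
      linarith)
    (fun a u => by
      rcases eq_or_ne a 0 with rfl | ha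
      · simp only [zero_smul, norm_zero, zero_mul]
        exact csInf_le (projValues_bddBelow p q 0) ⟨[], by simp, by simp⟩
      · have ha' : 0 < ‖a‖ := norm_pos_iff.2 ha
        rw [mul_comm, ← div_le_iff₀ ha']
        refine le_csInf (projValues_nonempty p q u) fun c hc => ?_
        rw [div_le_iff₀ ha', mul_comm]
        exact csInf_le (projValues_bddBelow p q _) (projValues_smul p q a hc))

theorem projSeminorm_apply (p : Seminorm ℂ E) (q : Seminorm ℂ F) (u : E ⊗[ℂ] F) :
    projSeminorm p q u = sInf (projValues p q u) := rfl

theorem projSeminorm_tmul_le (p : Seminorm ℂ E) (q : Seminorm ℂ F) (x : E) (y : F) :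
    projSeminorm p q (x ⊗ₜ[ℂ] y) ≤ p x * q y :=
  csInf_le (projValues_bddBelow p q _) (projValues_tmul p q x y)

theorem le_projSeminorm (p : Seminorm ℂ E) (q : Seminorm ℂ F) (r : Seminorm ℂ (E ⊗[ℂ] F))
    {C : ℝ} (hC : 0 ≤ C) (h : ∀ x y, r (x ⊗ₜ[ℂ] y) ≤ C * (p x * q y)) (u : E ⊗[ℂ] F) :
    r u ≤ C * projSeminorm p q u := by
  have key : ∀ l : List (E × F), r (l.map fun z => z.1 ⊗ₜ[ℂ] z.2).sum ≤
      C * (l.map fun z => p z.1 * q z.2).sum := by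
    intro l
    induction l with
    | nil => simp
    | cons z l ih =>
      simp only [List.map_cons, List.sum_cons, mul_add]
      exact (map_add_le_add r _ _).trans (add_le_add (h _ _) ih)
  rcases hC.eq_or_lt with rfl | hC
  · obtain ⟨c, l, rfl, -⟩ := projValues_nonempty p q u
    simpa using key l
  · rw [mul_comm, ← div_le_iff₀ hC]
    refine le_csInf (projValues_nonempty p q u) ?_
    rintro c ⟨l, rfl, rfl⟩
    rw [div_le_iff₀ hC, mul_comm]
    exact key l

end ProjectiveSeminorm

section ProjTensor

variable (E F : Type*)
  [AddCommGroup E] [Module ℂ E] [UniformSpace E]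
  [AddCommGroup F] [Module ℂ F] [UniformSpace F]

/-- The defining seminorms of the projective topology on `E ⊗ F`: the seminorms `p ⊗ q`, where
`p` and `q` are continuous seminorms on `E` and `F`. -/
def projSeminorms : Set (Seminorm ℂ (E ⊗[ℂ] F)) :=
  {r | ∃ p : Seminorm ℂ E, ∃ q : Seminorm ℂ F, Continuous p ∧ Continuous q ∧
    r = projSeminorm p q}

/-- The algebraic tensor product `E ⊗ F` with the projective topology. -/
abbrev ProjTensor : Type _ := SeminormTop (projSeminorms E F)

/-- The completed projective tensor product of `E` and `F`. -/
abbrev CProj : Type _ := SeminormCompletion (projSeminorms E F)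

end ProjTensor

section CProj

variable {E F G K E' F' : Type*}
  [AddCommGroup E] [Module ℂ E] [UniformSpace E] [IsUniformAddGroup E]
  [UniformContinuousConstSMul ℂ E] [PolynormableSpace ℂ E]
  [AddCommGroup F] [Module ℂ F] [UniformSpace F] [IsUniformAddGroup F]
  [UniformContinuousConstSMul ℂ F] [PolynormableSpace ℂ F]
  [AddCommGroup G] [Module ℂ G] [UniformSpace G] [IsUniformAddGroup G]
  [UniformContinuousConstSMul ℂ G] [PolynormableSpace ℂ G]
  [AddCommGroup K] [Module ℂ K] [UniformSpace K] [IsUniformAddGroup K]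
  [UniformContinuousConstSMul ℂ K] [PolynormableSpace ℂ K]
  [AddCommGroup E'] [Module ℂ E'] [UniformSpace E'] [IsUniformAddGroup E']
  [UniformContinuousConstSMul ℂ E'] [PolynormableSpace ℂ E']
  [AddCommGroup F'] [Module ℂ F'] [UniformSpace F'] [IsUniformAddGroup F']
  [UniformContinuousConstSMul ℂ F'] [PolynormableSpace ℂ F']

theorem continuous_projSeminorm {p : Seminorm ℂ E} {q : Seminorm ℂ F} (hp : Continuous p)
    (hq : Continuous q) :
    Continuous ((projSeminorm p q).comp (toSeminormTop (projSeminorms E F)).symm.toLinearMap) :=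
  (SeminormTop.withSeminorms (projSeminorms E F)).continuous_seminorm ⟨_, p, q, hp, hq, rfl⟩

variable (E F) in
/-- The canonical map of the algebraic tensor product `E ⊗ F` to `E ⊗̂ F`. -/
def toCProj : E ⊗[ℂ] F →ₗ[ℂ] CProj E F := embed (projSeminorms E F)

variable (E F) in
/-- The canonical bilinear map `E × F → E ⊗̂ F`. -/
def ctmul : E →ₗ[ℂ] F →ₗ[ℂ] CProj E F := (TensorProduct.mk ℂ E F).compr₂ (toCProj E F)

theorem toCProj_tmul (x : E) (y : F) : toCProj E F (x ⊗ₜ[ℂ] y) = ctmul E F x y := rfl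

theorem continuous_ctmul : Continuous fun z : E × F => ctmul E F z.1 z.2 := by
  have h : Continuous fun z : E × F =>
      ((TensorProduct.mk ℂ E F).compr₂ (toSeminormTop (projSeminorms E F)).toLinearMap) z.1 z.2 := by
    refine continuous_bilin_of_bound (SeminormTop.withSeminorms (projSeminorms E F)) _ ?_
    rintro ⟨_, p, q, hp, hq, rfl⟩
    exact ⟨p, hp, q, hq, fun x y => projSeminorm_tmul_le p q x y⟩
  exact (toComplL (ProjTensor E F)).continuous.comp h

theorem denseRange_toCProj : DenseRange (toCProj E F) :=
  Completion.denseRange_coe (α := ProjTensor E F)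

variable [T0Space G] [CompleteSpace G]

theorem continuous_lift_projTensor (b : E →ₗ[ℂ] F →ₗ[ℂ] G)
    (hb : Continuous fun z : E × F => b z.1 z.2) :
    Continuous ((TensorProduct.lift b) ∘ₗ
      (toSeminormTop (projSeminorms E F)).symm.toLinearMap) := by
  refine (PolynormableSpace.withSeminorms ℂ G).continuous_of_continuous_comp _ ?_
  rintro ⟨r, hr⟩
  obtain ⟨p, hp, q, hq, h⟩ := exists_bound_of_continuous_bilin b hb hr
  refine Seminorm.continuous_of_le (continuous_projSeminorm hp hq) fun u => ?_
  have := le_projSeminorm p q (r.comp (TensorProduct.lift b)) zero_le_one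
    (fun x y => by simpa using h x y) ((toSeminormTop (projSeminorms E F)).symm u)
  simpa using this

/-- The universal property of `E ⊗̂ F`: the continuous linear map `E ⊗̂ F → G` induced by a jointly
continuous bilinear map `E × F → G`. -/
def CProj.lift (b : E →ₗ[ℂ] F →ₗ[ℂ] G) (hb : Continuous fun z : E × F => b z.1 z.2) :
    CProj E F →L[ℂ] G :=
  ContinuousLinearMap.fromCompletion
    { toLinearMap := (TensorProduct.lift b) ∘ₗ (toSeminormTop (projSeminorms E F)).symm.toLinearMap
      cont := continuous_lift_projTensor b hb }

theorem CProj.lift_toCProj (b : E →ₗ[ℂ] F →ₗ[ℂ] G) (hb : Continuous fun z : E × F => b z.1 z.2)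
    (u : E ⊗[ℂ] F) : CProj.lift b hb (toCProj E F u) = TensorProduct.lift b u :=
  ContinuousLinearMap.fromCompletion_apply_coe _ _

@[simp]
theorem CProj.lift_ctmul (b : E →ₗ[ℂ] F →ₗ[ℂ] G) (hb : Continuous fun z : E × F => b z.1 z.2)
    (x : E) (y : F) : CProj.lift b hb (ctmul E F x y) = b x y := by
  rw [← toCProj_tmul, CProj.lift_toCProj, TensorProduct.lift.tmul]

/-- The completed tensor product `f ⊗̂ g` of continuous linear maps. -/
def CProj.map (f : E →L[ℂ] E') (g : F →L[ℂ] F') : CProj E F →L[ℂ] CProj E' F' :=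
  CProj.lift ((ctmul E' F').compl₁₂ f.toLinearMap g.toLinearMap)
    (continuous_ctmul.comp (f.continuous.prodMap g.continuous))

@[simp]
theorem CProj.map_ctmul (f : E →L[ℂ] E') (g : F →L[ℂ] F') (x : E) (y : F) :
    CProj.map f g (ctmul E F x y) = ctmul E' F' (f x) (g y) :=
  CProj.lift_ctmul _ _ x y

variable (E F) in
/-- The flip `E ⊗̂ F → F ⊗̂ E`. -/
def CProj.comm : CProj E F →L[ℂ] CProj F E :=
  CProj.lift (ctmul F E).flip (continuous_ctmul.comp continuous_swap)

@[simp]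
theorem CProj.comm_ctmul (x : E) (y : F) :
    CProj.comm E F (ctmul E F x y) = ctmul F E y x :=
  CProj.lift_ctmul _ _ x y

/-- The bilinear map `(E ⊗̂ F) × G → K` induced by a trilinear map `E × F × G → K`. -/
def trilinToBilin (t : E →ₗ[ℂ] F →ₗ[ℂ] K →ₗ[ℂ] G) : ProjTensor E F →ₗ[ℂ] K →ₗ[ℂ] G :=
  (TensorProduct.lift t) ∘ₗ (toSeminormTop (projSeminorms E F)).symm.toLinearMap

theorem continuous_trilinToBilin (t : E →ₗ[ℂ] F →ₗ[ℂ] K →ₗ[ℂ] G)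
    (ht : ∀ r : Seminorm ℂ G, Continuous r → ∃ p : Seminorm ℂ E, Continuous p ∧
      ∃ q : Seminorm ℂ F, Continuous q ∧ ∃ s : Seminorm ℂ K, Continuous s ∧
      ∀ x y z, r (t x y z) ≤ p x * q y * s z) :
    Continuous fun w : ProjTensor E F × K => trilinToBilin t w.1 w.2 := by
  refine continuous_bilin_of_bound (PolynormableSpace.withSeminorms ℂ G) _ ?_
  rintro ⟨r, hr⟩
  obtain ⟨p, hp, q, hq, s, hs, h⟩ := ht r hr
  refine ⟨_, continuous_projSeminorm hp hq, s, hs, fun u z => ?_⟩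
  have := le_projSeminorm p q (r.comp ((TensorProduct.lift t).flip z)) (apply_nonneg s z)
    (fun x y => by simpa [mul_comm, mul_assoc, mul_left_comm] using h x y z)
    ((toSeminormTop (projSeminorms E F)).symm u)
  rw [mul_comm]
  exact this

/-- The continuous linear map `(E ⊗̂ F) ⊗̂ K → G` induced by a jointly continuous trilinear map. -/
def CProj.lift₃ (t : E →ₗ[ℂ] F →ₗ[ℂ] K →ₗ[ℂ] G)
    (ht : ∀ r : Seminorm ℂ G, Continuous r → ∃ p : Seminorm ℂ E, Continuous p ∧
      ∃ q : Seminorm ℂ F, Continuous q ∧ ∃ s : Seminorm ℂ K, Continuous s ∧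
      ∀ x y z, r (t x y z) ≤ p x * q y * s z) : CProj (CProj E F) K →L[ℂ] G :=
  CProj.lift (E := CProj E F)
    ((extendBilin (trilinToBilin t) (continuous_trilinToBilin t ht)).compl₂
      (toComplL K).toLinearMap)
    ((continuous_extendBilin (trilinToBilin t) (continuous_trilinToBilin t ht)).comp
      (continuous_fst.prodMk ((toComplL K).continuous.comp continuous_snd)))

theorem CProj.lift₃_ctmul (t : E →ₗ[ℂ] F →ₗ[ℂ] K →ₗ[ℂ] G)
    (ht : ∀ r : Seminorm ℂ G, Continuous r → ∃ p : Seminorm ℂ E, Continuous p ∧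
      ∃ q : Seminorm ℂ F, Continuous q ∧ ∃ s : Seminorm ℂ K, Continuous s ∧
      ∀ x y z, r (t x y z) ≤ p x * q y * s z) (x : E) (y : F) (z : K) :
    CProj.lift₃ t ht (ctmul _ _ (ctmul E F x y) z) = t x y z := by
  refine (CProj.lift_ctmul (E := CProj E F) _ _ _ _).trans ?_
  exact extendBilin_coe (trilinToBilin t) (continuous_trilinToBilin t ht)
    (toSeminormTop (projSeminorms E F) (x ⊗ₜ[ℂ] y)) z

variable (E F K) in
/-- The trilinear map `(x, y, z) ↦ x ⊗ (y ⊗ z)`. -/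
def ctmul₃ : E →ₗ[ℂ] F →ₗ[ℂ] K →ₗ[ℂ] CProj E (CProj F K) :=
  LinearMap.mk₂ ℂ (fun x y => (ctmul E (CProj F K) x) ∘ₗ (ctmul F K y))
    (fun x x' y => by ext z; simp) (fun c x y => by ext z; simp)
    (fun x y y' => by ext z; simp) (fun c x y => by ext z; simp)

theorem ctmul₃_bound (r : Seminorm ℂ (CProj E (CProj F K))) (hr : Continuous r) :
    ∃ p : Seminorm ℂ E, Continuous p ∧
      ∃ q : Seminorm ℂ F, Continuous q ∧ ∃ s : Seminorm ℂ K, Continuous s ∧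
      ∀ x y z, r (ctmul₃ E F K x y z) ≤ p x * q y * s z := by
  obtain ⟨p, hp, w, hw, h⟩ :=
    exists_bound_of_continuous_bilin (ctmul E (CProj F K)) continuous_ctmul hr
  obtain ⟨q, hq, s, hs, h'⟩ := exists_bound_of_continuous_bilin (ctmul F K) continuous_ctmul hw
  refine ⟨p, hp, q, hq, s, hs, fun x y z => (h x _).trans ?_⟩
  rw [mul_assoc]
  exact mul_le_mul_of_nonneg_left (h' y z) (apply_nonneg p x)

variable (E F K) in
/-- The associativity map `(E ⊗̂ F) ⊗̂ K → E ⊗̂ (F ⊗̂ K)`. -/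
def CProj.assoc : CProj (CProj E F) K →L[ℂ] CProj E (CProj F K) :=
  CProj.lift₃ (ctmul₃ E F K) ctmul₃_bound

@[simp]
theorem CProj.assoc_ctmul (x : E) (y : F) (z : K) :
    CProj.assoc E F K (ctmul _ _ (ctmul E F x y) z) = ctmul _ _ x (ctmul F K y z) :=
  CProj.lift₃_ctmul _ _ x y z

variable (E F K) in
/-- The associativity map `E ⊗̂ (F ⊗̂ K) → (E ⊗̂ F) ⊗̂ K`, the inverse of `CProj.assoc`. -/
def CProj.assocInv : CProj E (CProj F K) →L[ℂ] CProj (CProj E F) K :=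
  (CProj.comm K (CProj E F)) ∘L (CProj.assoc K E F) ∘L (CProj.comm F (CProj K E)) ∘L
    (CProj.assoc F K E) ∘L (CProj.comm E (CProj F K))

@[simp]
theorem CProj.assocInv_ctmul (x : E) (y : F) (z : K) :
    CProj.assocInv E F K (ctmul _ _ x (ctmul F K y z)) = ctmul _ _ (ctmul E F x y) z := by
  simp [CProj.assocInv]

end CProj

/-! ### Module algebras and the smash product -/

section Smash

variable (H A : Type*) [Ring H] [Bialgebra ℂ H] [Ring A] [Algebra ℂ A] [Module H A]
  [IsScalarTower ℂ H A]

/-- The action of `H` on `A` as a bilinear map. -/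
def actionBilin : H →ₗ[ℂ] A →ₗ[ℂ] A := (Algebra.lsmul ℂ ℂ A).toLinearMap

@[simp]
theorem actionBilin_apply (h : H) (a : A) : actionBilin H A h a = h • a := rfl

/-- `A` is an `H`-module algebra: the product `A ⊗ A → A` and the unit map `ℂ → A` are morphisms of
`H`-modules, i.e. `h • (a b) = ∑ (h₍₁₎ • a) (h₍₂₎ • b)` and `h • 1 = ε(h) 1`. -/
class IsModuleAlgebra : Prop where
  smul_mul : ∀ (h : H) (a b : A), h • (a * b) =
    LinearMap.mul' ℂ A (TensorProduct.map ((actionBilin H A).flip a) ((actionBilin H A).flip b)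
      (Coalgebra.comul (R := ℂ) h))
  smul_one : ∀ h : H, h • (1 : A) = algebraMap ℂ A (Coalgebra.counit (R := ℂ) h)

/-- The map `τ : H ⊗ A → A ⊗ H`, `τ(h ⊗ a) = ∑ h₍₁₎ • a ⊗ h₍₂₎`, as the composition
`H ⊗ A → (H ⊗ H) ⊗ A → H ⊗ (H ⊗ A) → H ⊗ (A ⊗ H) → (H ⊗ A) ⊗ H → A ⊗ H`. -/
def smashTau : H ⊗[ℂ] A →ₗ[ℂ] A ⊗[ℂ] H :=
  TensorProduct.map (TensorProduct.lift (actionBilin H A)) LinearMap.id ∘ₗ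
  (TensorProduct.assoc ℂ H A H).symm.toLinearMap ∘ₗ
  TensorProduct.map LinearMap.id (TensorProduct.comm ℂ H A).toLinearMap ∘ₗ
  (TensorProduct.assoc ℂ H H A).toLinearMap ∘ₗ
  TensorProduct.map (Coalgebra.comul (R := ℂ)) LinearMap.id

/-- The map `id ⊗ μ_H` preceded by `τ ⊗ id`: `H ⊗ (A ⊗ H) → A ⊗ H`,
`h ⊗ (a ⊗ k) ↦ ∑ h₍₁₎ • a ⊗ h₍₂₎ k`. -/
def smashInner : H ⊗[ℂ] (A ⊗[ℂ] H) →ₗ[ℂ] A ⊗[ℂ] H :=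
  TensorProduct.map LinearMap.id (LinearMap.mul' ℂ H) ∘ₗ
  (TensorProduct.assoc ℂ A H H).toLinearMap ∘ₗ
  TensorProduct.map (smashTau H A) LinearMap.id ∘ₗ
  (TensorProduct.assoc ℂ H A H).symm.toLinearMap

/-- The multiplication of the smash product,
`(μ_A ⊗ μ_H) ∘ (id_A ⊗ τ ⊗ id_H) : (A ⊗ H) ⊗ (A ⊗ H) → A ⊗ H`. -/
def smashMul : (A ⊗[ℂ] H) ⊗[ℂ] (A ⊗[ℂ] H) →ₗ[ℂ] A ⊗[ℂ] H :=
  TensorProduct.map (LinearMap.mul' ℂ A) LinearMap.id ∘ₗ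
  (TensorProduct.assoc ℂ A A H).symm.toLinearMap ∘ₗ
  TensorProduct.map LinearMap.id (smashInner H A) ∘ₗ
  (TensorProduct.assoc ℂ A H (A ⊗[ℂ] H)).toLinearMap

theorem smashMul_apply (t : (A ⊗[ℂ] H) ⊗[ℂ] (A ⊗[ℂ] H)) :
    smashMul H A t =
      TensorProduct.map (LinearMap.mul' ℂ A) LinearMap.id ((TensorProduct.assoc ℂ A A H).symm
        (TensorProduct.map LinearMap.id (smashInner H A)
          (TensorProduct.assoc ℂ A H (A ⊗[ℂ] H) t))) := rfl

variable {H A}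

theorem smashTau_tmul {ι : Type*} (h : H) (a : A) (r : Coalgebra.Repr ℂ h ι) :
    smashTau H A (h ⊗ₜ a) = ∑ i ∈ r.index, (r.left i • a) ⊗ₜ[ℂ] r.right i := by
  simp [smashTau, ← r.eq, TensorProduct.sum_tmul]

theorem smashMul_tmul {ι : Type*} (a b : A) (h k : H) (r : Coalgebra.Repr ℂ h ι) :
    smashMul H A ((a ⊗ₜ h) ⊗ₜ (b ⊗ₜ k)) =
      ∑ i ∈ r.index, (a * r.left i • b) ⊗ₜ[ℂ] (r.right i * k) := by
  simp [smashMul, smashInner, smashTau_tmul h b r, TensorProduct.sum_tmul, TensorProduct.tmul_sum]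

theorem smul_mul_repr [IsModuleAlgebra H A] {ι : Type*} (h : H) (a b : A)
    (r : Coalgebra.Repr ℂ h ι) :
    h • (a * b) = ∑ i ∈ r.index, (r.left i • a) * (r.right i • b) := by
  rw [IsModuleAlgebra.smul_mul h a b, ← r.eq]
  simp

/-- The product of two representations of `Δ h` and `Δ k` represents `Δ (h k)`. -/
def reprMul {ι κ : Type*} {h k : H} (r : Coalgebra.Repr ℂ h ι) (s : Coalgebra.Repr ℂ k κ) :
    Coalgebra.Repr ℂ (h * k) (ι × κ) where
  index := r.index ×ˢ s.index
  left i := r.left i.1 * s.left i.2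
  right i := r.right i.1 * s.right i.2
  eq := by
    rw [Bialgebra.comul_mul, ← r.eq, ← s.eq, Finset.sum_mul_sum, Finset.sum_product]
    simp

/-- The representation `Δ 1 = 1 ⊗ 1`. -/
def reprOne : Coalgebra.Repr ℂ (1 : H) Unit where
  index := {()}
  left _ := 1
  right _ := 1
  eq := by simp [Algebra.TensorProduct.one_def]

theorem smashMul_one_left (x : A ⊗[ℂ] H) : smashMul H A ((1 ⊗ₜ 1) ⊗ₜ x) = x := by
  induction x using TensorProduct.induction_on with
  | zero => simp
  | tmul a h => rw [smashMul_tmul 1 a 1 h reprOne]; simp [reprOne]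
  | add x y hx hy => rw [TensorProduct.tmul_add, map_add, hx, hy]

theorem smashMul_one_right [IsModuleAlgebra H A] (x : A ⊗[ℂ] H) :
    smashMul H A (x ⊗ₜ (1 ⊗ₜ 1)) = x := by
  induction x using TensorProduct.induction_on with
  | zero => simp
  | tmul a h =>
    let r := Coalgebra.Repr.arbitrary ℂ h
    rw [smashMul_tmul a 1 h 1 r]
    simp only [IsModuleAlgebra.smul_one, mul_one]
    simp_rw [← Algebra.commutes, ← Algebra.smul_def, TensorProduct.smul_tmul]
    rw [← TensorProduct.tmul_sum, Coalgebra.sum_counit_smul r]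
  | add x y hx hy => rw [TensorProduct.add_tmul, map_add, hx, hy]

theorem smashMul_assoc [IsModuleAlgebra H A] (x y z : A ⊗[ℂ] H) :
    smashMul H A (smashMul H A (x ⊗ₜ y) ⊗ₜ z) = smashMul H A (x ⊗ₜ smashMul H A (y ⊗ₜ z)) := by
  induction x using TensorProduct.induction_on with
  | zero => simp
  | add x x' hx hx' => simp only [TensorProduct.add_tmul, map_add, hx, hx']
  | tmul a h =>
  induction y using TensorProduct.induction_on with
  | zero => simp
  | add x x' hx hx' => simp only [TensorProduct.add_tmul, TensorProduct.tmul_add, map_add, hx, hx']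
  | tmul b k =>
  induction z using TensorProduct.induction_on with
  | zero => simp
  | add x x' hx hx' => simp only [TensorProduct.tmul_add, map_add, hx, hx']
  | tmul c l =>
    let r := Coalgebra.Repr.arbitrary ℂ h
    let s := Coalgebra.Repr.arbitrary ℂ k
    let r₁ := fun i => Coalgebra.Repr.arbitrary ℂ (r.left i)
    let r₂ := fun i => Coalgebra.Repr.arbitrary ℂ (r.right i)
    rw [smashMul_tmul a b h k r, smashMul_tmul b c k l s, TensorProduct.sum_tmul,
      TensorProduct.tmul_sum, map_sum, map_sum]
    have h1 : ∀ i, smashMul H A ((a * r.left i • b) ⊗ₜ (r.right i * k) ⊗ₜ[ℂ] (c ⊗ₜ l)) =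
        ∑ j ∈ s.index, ∑ m ∈ (r₂ i).index,
          (a * r.left i • b * (((r₂ i).left m * s.left j) • c)) ⊗ₜ[ℂ]
            ((r₂ i).right m * s.right j * l) := by
      intro i
      rw [smashMul_tmul _ _ _ _ (reprMul (r₂ i) s)]
      simp only [reprMul, Finset.sum_product]
      exact Finset.sum_comm
    have h2 : ∀ j, smashMul H A ((a ⊗ₜ h) ⊗ₜ[ℂ] ((b * s.left j • c) ⊗ₜ (s.right j * l))) =
        ∑ i ∈ r.index, ∑ m ∈ (r₁ i).index,
          (a * ((r₁ i).left m • b * (((r₁ i).right m * s.left j) • c))) ⊗ₜ[ℂ]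
            (r.right i * (s.right j * l)) := by
      intro j
      rw [smashMul_tmul _ _ _ _ r]
      refine Finset.sum_congr rfl fun i _ => ?_
      rw [smul_mul_repr (r.left i) b (s.left j • c) (r₁ i), Finset.mul_sum,
        TensorProduct.sum_tmul]
      simp only [mul_smul]
    simp_rw [h1, h2]
    rw [Finset.sum_comm]
    refine Finset.sum_congr rfl fun j _ => ?_
    let Φ : H ⊗[ℂ] (H ⊗[ℂ] H) →ₗ[ℂ] A ⊗[ℂ] H :=
      TensorProduct.map (LinearMap.mulLeft ℂ a ∘ₗ LinearMap.mul' ℂ A)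
          (LinearMap.mulRight ℂ (s.right j * l)) ∘ₗ
        (TensorProduct.assoc ℂ A A H).symm.toLinearMap ∘ₗ
        TensorProduct.map ((actionBilin H A).flip b)
          (TensorProduct.map ((actionBilin H A).flip (s.left j • c)) LinearMap.id)
    have h3 := congrArg Φ (Coalgebra.sum_tmul_tmul_eq r r₁ r₂)
    simp only [map_sum] at h3
    simpa [Φ, mul_smul, mul_assoc] using h3.symm

end Smash

section SmashRing

variable (A H : Type*) [Ring H] [Bialgebra ℂ H] [Ring A] [Algebra ℂ A] [Module H A]
  [IsScalarTower ℂ H A]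

/-- The smash product `A # H`: the vector space `A ⊗ H` with the multiplication
`(a ⊗ h)(a' ⊗ h') = ∑ a (h₍₁₎ • a') ⊗ h₍₂₎ h'`. -/
def SmashProduct : Type _ := A ⊗[ℂ] H

instance : AddCommGroup (SmashProduct A H) := inferInstanceAs (AddCommGroup (A ⊗[ℂ] H))

instance : Module ℂ (SmashProduct A H) := inferInstanceAs (Module ℂ (A ⊗[ℂ] H))

/-- The identity map `A ⊗ H → A # H`. -/
def toSmash : A ⊗[ℂ] H ≃ₗ[ℂ] SmashProduct A H := LinearEquiv.refl ℂ _

instance : Mul (SmashProduct A H) :=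
  ⟨fun x y => toSmash A H (smashMul H A ((toSmash A H).symm x ⊗ₜ (toSmash A H).symm y))⟩

instance : One (SmashProduct A H) := ⟨toSmash A H (1 ⊗ₜ 1)⟩

theorem SmashProduct.mul_def (x y : SmashProduct A H) :
    x * y = toSmash A H (smashMul H A ((toSmash A H).symm x ⊗ₜ (toSmash A H).symm y)) := rfl

theorem SmashProduct.one_def : (1 : SmashProduct A H) = toSmash A H (1 ⊗ₜ 1) := rfl

variable [IsModuleAlgebra H A]

instance : Ring (SmashProduct A H) :=
  { (inferInstance : AddCommGroup (SmashProduct A H)),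
    (inferInstance : Mul (SmashProduct A H)), (inferInstance : One (SmashProduct A H)) with
    left_distrib := fun x y z => by
      simp only [SmashProduct.mul_def, map_add, TensorProduct.tmul_add]
    right_distrib := fun x y z => by
      simp only [SmashProduct.mul_def, map_add, TensorProduct.add_tmul]
    zero_mul := fun x => by simp [SmashProduct.mul_def]
    mul_zero := fun x => by simp [SmashProduct.mul_def]
    mul_assoc := fun x y z => by
      simp only [SmashProduct.mul_def, LinearEquiv.symm_apply_apply, smashMul_assoc]
    one_mul := fun x => by
      simp only [SmashProduct.mul_def, SmashProduct.one_def, LinearEquiv.symm_apply_apply,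
        smashMul_one_left, LinearEquiv.apply_symm_apply]
    mul_one := fun x => by
      simp only [SmashProduct.mul_def, SmashProduct.one_def, LinearEquiv.symm_apply_apply,
        smashMul_one_right, LinearEquiv.apply_symm_apply] }

instance : Algebra ℂ (SmashProduct A H) :=
  Algebra.ofModule
    (fun c x y => by
      simp only [SmashProduct.mul_def, map_smul, ← TensorProduct.smul_tmul'])
    (fun c x y => by
      simp only [SmashProduct.mul_def, map_smul, TensorProduct.tmul_smul])

end SmashRing

/-! ### Arens–Michael envelopes and `H`-completions -/

section Envelope

/-- A seminorm `p` on an algebra is submultiplicative if `p(ab) ≤ p(a) p(b)`. -/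
def IsSubmultiplicative {A : Type*} [Ring A] [Algebra ℂ A] (p : Seminorm ℂ A) : Prop :=
  ∀ a b : A, p (a * b) ≤ p a * p b

/-- A family of submultiplicative seminorms. -/
class IsSubmultFamily {A : Type*} [Ring A] [Algebra ℂ A] (P : Set (Seminorm ℂ A)) : Prop where
  submult : ∀ p ∈ P, IsSubmultiplicative p

section Algebra

variable {A : Type*} [Ring A] [Algebra ℂ A] (P : Set (Seminorm ℂ A))

instance : Ring (SeminormTop P) := inferInstanceAs (Ring A)

instance : Algebra ℂ (SeminormTop P) := inferInstanceAs (Algebra ℂ A)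

instance [IsSubmultFamily P] : IsTopologicalRing (SeminormTop P) where
  continuous_mul := by
    refine continuous_bilin_of_bound (SeminormTop.withSeminorms P)
      (LinearMap.mul ℂ (SeminormTop P)) fun i => ?_
    refine ⟨_, (SeminormTop.withSeminorms P).continuous_seminorm i, _,
      (SeminormTop.withSeminorms P).continuous_seminorm i, fun x y => ?_⟩
    exact IsSubmultFamily.submult i.1 i.2 x y

/-- The canonical homomorphism of the algebra `A` to its completion with respect to a family of
submultiplicative seminorms. -/
def toSeminormCompletion [IsSubmultFamily P] : A →ₐ[ℂ] SeminormCompletion P where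
  toFun a := ((toSeminormTop P a : SeminormTop P) : Completion (SeminormTop P))
  map_one' := Completion.coe_one (SeminormTop P)
  map_mul' a b := Completion.coe_mul (α := SeminormTop P) (toSeminormTop P a) (toSeminormTop P b)
  map_zero' := Completion.coe_zero (α := SeminormTop P)
  map_add' a b := Completion.coe_add (α := SeminormTop P) (toSeminormTop P a) (toSeminormTop P b)
  commutes' _ := rfl

theorem denseRange_toSeminormCompletion [IsSubmultFamily P] :
    DenseRange (toSeminormCompletion P) :=
  Completion.denseRange_coe (α := SeminormTop P)

end Algebra

variable (H A : Type*) [Ring H] [Algebra ℂ H] [Ring A] [Algebra ℂ A]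

/-- The family of all submultiplicative seminorms on `A`. -/
def submultSeminorms : Set (Seminorm ℂ A) := {p | IsSubmultiplicative p}

instance : IsSubmultFamily (submultSeminorms A) := ⟨fun _ hp => hp⟩

/-- The Arens–Michael envelope of `A`: the completion of `A` with respect to the family of all
submultiplicative seminorms. -/
abbrev AMEnvelope : Type _ := SeminormCompletion (submultSeminorms A)

/-- The canonical homomorphism of `A` to its Arens–Michael envelope. -/
abbrev toAMEnvelope : A →ₐ[ℂ] AMEnvelope A := toSeminormCompletion (submultSeminorms A)

/-- A seminorm `p` on an `H`-module `A` is `H`-stable if for each `h : H` there is `C > 0` such that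
`p (h • a) ≤ C p(a)` for all `a`. -/
def IsStable [Module H A] (p : Seminorm ℂ A) : Prop :=
  ∀ h : H, ∃ C > 0, ∀ a : A, p (h • a) ≤ C * p a

/-- The family of all `H`-stable submultiplicative seminorms on `A`. -/
def stableSeminorms [Module H A] : Set (Seminorm ℂ A) :=
  {p | IsStable H A p ∧ IsSubmultiplicative p}

instance [Module H A] : IsSubmultFamily (stableSeminorms H A) := ⟨fun _ hp => hp.2⟩

/-- The `H`-completion of `A`: the completion of `A` with respect to the family of all `H`-stable
submultiplicative seminorms. -/
abbrev HCompletion [Module H A] : Type _ := SeminormCompletion (stableSeminorms H A)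

/-- The canonical homomorphism of `A` to its `H`-completion. -/
abbrev toHCompletion [Module H A] : A →ₐ[ℂ] HCompletion H A :=
  toSeminormCompletion (stableSeminorms H A)

/-- The multiplication of a completion, as a continuous linear map `B ⊗̂ B → B`. -/
def completionMul {A : Type*} [Ring A] [Algebra ℂ A] (P : Set (Seminorm ℂ A))
    [IsSubmultFamily P] :
    CProj (SeminormCompletion P) (SeminormCompletion P) →L[ℂ] SeminormCompletion P :=
  CProj.lift (LinearMap.mul ℂ (SeminormCompletion P)) continuous_mul

end Envelope

/-! ### The comultiplication of the Arens–Michael envelope -/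

section Comul

variable (H : Type*) [Ring H] [Bialgebra ℂ H]

theorem IsSubmultiplicative.proj {A B : Type*} [Ring A] [Algebra ℂ A] [Ring B] [Algebra ℂ B]
    {p : Seminorm ℂ A} {q : Seminorm ℂ B}
    (hp : IsSubmultiplicative p) (hq : IsSubmultiplicative q) :
    IsSubmultiplicative (projSeminorm p q) := by
  have h1 : ∀ (u : A ⊗[ℂ] B) (x : A) (y : B),
      projSeminorm p q (u * (x ⊗ₜ y)) ≤ (p x * q y) * projSeminorm p q u := by
    intro u x y
    refine le_projSeminorm p q ((projSeminorm p q).comp (LinearMap.mulRight ℂ (x ⊗ₜ[ℂ] y)))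
      (mul_nonneg (apply_nonneg p x) (apply_nonneg q y)) (fun x' y' => ?_) u
    simp only [Seminorm.comp_apply, LinearMap.mulRight_apply, Algebra.TensorProduct.tmul_mul_tmul]
    refine (projSeminorm_tmul_le p q _ _).trans ?_
    refine (mul_le_mul (hp _ _) (hq _ _) (apply_nonneg q _)
      (mul_nonneg (apply_nonneg p _) (apply_nonneg p _))).trans (le_of_eq ?_)
    ring
  intro u v
  refine le_projSeminorm p q ((projSeminorm p q).comp (LinearMap.mulLeft ℂ u))
      (apply_nonneg _ u) (fun x y => ?_) v
  rw [mul_comm]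
  exact h1 u x y

theorem IsSubmultiplicative.sup {A : Type*} [Ring A] [Algebra ℂ A] {p q : Seminorm ℂ A}
    (hp : IsSubmultiplicative p) (hq : IsSubmultiplicative q) : IsSubmultiplicative (p ⊔ q) := by
  intro a b
  simp only [Seminorm.sup_apply]
  refine max_le ((hp a b).trans ?_) ((hq a b).trans ?_)
  · exact mul_le_mul (le_max_left _ _) (le_max_left _ _) (apply_nonneg p b)
      ((apply_nonneg p a).trans (le_max_left _ _))
  · exact mul_le_mul (le_max_right _ _) (le_max_right _ _) (apply_nonneg q b)
      ((apply_nonneg p a).trans (le_max_left _ _))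

theorem IsSubmultiplicative.finset_sup {A : Type*} [Ring A] [Algebra ℂ A] {ι : Type*}
    (p : ι → Seminorm ℂ A) (hp : ∀ i, IsSubmultiplicative (p i)) (s : Finset ι) :
    IsSubmultiplicative (s.sup p) := by
  refine Finset.sup_induction ?_ (fun _ h _ h' => h.sup h') fun i _ => hp i
  intro a b
  simp

theorem IsSubmultiplicative.smul {A : Type*} [Ring A] [Algebra ℂ A] {p : Seminorm ℂ A}
    (hp : IsSubmultiplicative p) {C : ℝ≥0} (hC : 1 ≤ C) : IsSubmultiplicative (C • p) := by
  intro a b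
  have hC' : (1 : ℝ) ≤ C := hC
  have h1 : 0 ≤ p a * p b := mul_nonneg (apply_nonneg p a) (apply_nonneg p b)
  simp only [smul_apply, NNReal.smul_def, smul_eq_mul]
  calc (C : ℝ) * p (a * b) ≤ C * (p a * p b) :=
        mul_le_mul_of_nonneg_left (hp a b) (by linarith)
    _ ≤ C * (C * (p a * p b)) :=
        mul_le_mul_of_nonneg_left (le_mul_of_one_le_left h1 hC') (by linarith)
    _ = C * p a * (C * p b) := by ring

/-- Each continuous seminorm on the Arens–Michael envelope is dominated on `A` by a
submultiplicative seminorm. -/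
theorem exists_submult_le {A : Type*} [Ring A] [Algebra ℂ A] {r : Seminorm ℂ (AMEnvelope A)}
    (hr : Continuous r) :
    ∃ p : Seminorm ℂ A, IsSubmultiplicative p ∧ ∀ a, r (embed (submultSeminorms A) a) ≤ p a := by
  obtain ⟨s, C, -, h⟩ := Seminorm.bound_of_continuous
    (SeminormTop.withSeminorms (submultSeminorms A))
    (r.comp (toComplL (SeminormTop (submultSeminorms A))).toLinearMap)
    (hr.comp (toComplL (SeminormTop (submultSeminorms A))).continuous)
  have hs : IsSubmultiplicative (A := SeminormTop (submultSeminorms A))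
      (s.sup (SeminormTop.seminorm (submultSeminorms A))) :=
    IsSubmultiplicative.finset_sup _ (fun i => i.2) s
  have hs' := hs.smul (le_max_left 1 C)
  refine ⟨((max 1 C) • s.sup (SeminormTop.seminorm (submultSeminorms A))).comp
    (toSeminormTop (submultSeminorms A)).toLinearMap, fun a b => hs' _ _, fun a => ?_⟩
  refine (h (toSeminormTop (submultSeminorms A) a)).trans ?_
  simp only [Seminorm.comp_apply, smul_apply, NNReal.smul_def, smul_eq_mul]
  exact mul_le_mul_of_nonneg_right (by exact_mod_cast le_max_right _ _) (apply_nonneg _ _)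

section jmap

variable {X Y Z E F G E' F' : Type*} [AddCommGroup X] [Module ℂ X] [AddCommGroup Y] [Module ℂ Y]
  [AddCommGroup Z] [Module ℂ Z]
  [AddCommGroup E] [Module ℂ E] [UniformSpace E] [IsUniformAddGroup E]
  [UniformContinuousConstSMul ℂ E] [PolynormableSpace ℂ E]
  [AddCommGroup F] [Module ℂ F] [UniformSpace F] [IsUniformAddGroup F]
  [UniformContinuousConstSMul ℂ F] [PolynormableSpace ℂ F]
  [AddCommGroup G] [Module ℂ G] [UniformSpace G] [IsUniformAddGroup G]
  [UniformContinuousConstSMul ℂ G] [PolynormableSpace ℂ G]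
  [AddCommGroup E'] [Module ℂ E'] [UniformSpace E'] [IsUniformAddGroup E']
  [UniformContinuousConstSMul ℂ E'] [PolynormableSpace ℂ E']
  [AddCommGroup F'] [Module ℂ F'] [UniformSpace F'] [IsUniformAddGroup F']
  [UniformContinuousConstSMul ℂ F'] [PolynormableSpace ℂ F']

/-- The map `X ⊗ Y → E ⊗̂ F`, `x ⊗ y ↦ f(x) ⊗ g(y)`. -/
def jmap (f : X →ₗ[ℂ] E) (g : Y →ₗ[ℂ] F) : X ⊗[ℂ] Y →ₗ[ℂ] CProj E F :=
  toCProj E F ∘ₗ TensorProduct.map f g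

@[simp]
theorem jmap_tmul (f : X →ₗ[ℂ] E) (g : Y →ₗ[ℂ] F) (x : X) (y : Y) :
    jmap f g (x ⊗ₜ y) = ctmul E F (f x) (g y) := rfl

theorem map_jmap {X' Y' : Type*} [AddCommGroup X'] [Module ℂ X'] [AddCommGroup Y'] [Module ℂ Y']
    {f : X →ₗ[ℂ] E} {g : Y →ₗ[ℂ] F} {φ : E →L[ℂ] E'} {ψ : F →L[ℂ] F'}
    {f' : X' →ₗ[ℂ] E'} {g' : Y' →ₗ[ℂ] F'} {u : X →ₗ[ℂ] X'} {v : Y →ₗ[ℂ] Y'}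
    (hφ : ∀ x, φ (f x) = f' (u x)) (hψ : ∀ y, ψ (g y) = g' (v y)) (t : X ⊗[ℂ] Y) :
    CProj.map φ ψ (jmap f g t) = jmap f' g' (TensorProduct.map u v t) := by
  induction t using TensorProduct.induction_on with
  | zero => simp
  | tmul x y => simp [hφ, hψ]
  | add x y hx hy => simp only [map_add, hx, hy]

theorem map_id_jmap {Y' : Type*} [AddCommGroup Y'] [Module ℂ Y']
    (f : X →ₗ[ℂ] E) (g : Y →ₗ[ℂ] F) (ψ : F →L[ℂ] F') (g' : Y' →ₗ[ℂ] F') (v : Y →ₗ[ℂ] Y')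
    (hψ : ∀ y, ψ (g y) = g' (v y)) (t : X ⊗[ℂ] Y) :
    CProj.map (ContinuousLinearMap.id ℂ E) ψ (jmap f g t) =
      jmap f g' (TensorProduct.map LinearMap.id v t) :=
  map_jmap (f := f) (f' := f) (u := LinearMap.id) (fun _ => rfl) hψ t

theorem map_jmap_id {X' : Type*} [AddCommGroup X'] [Module ℂ X']
    (f : X →ₗ[ℂ] E) (g : Y →ₗ[ℂ] F) (φ : E →L[ℂ] E') (f' : X' →ₗ[ℂ] E') (u : X →ₗ[ℂ] X')
    (hφ : ∀ x, φ (f x) = f' (u x)) (t : X ⊗[ℂ] Y) :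
    CProj.map φ (ContinuousLinearMap.id ℂ F) (jmap f g t) =
      jmap f' g (TensorProduct.map u LinearMap.id t) :=
  map_jmap (g := g) (g' := g) (v := LinearMap.id) hφ (fun _ => rfl) t

theorem comm_jmap (f : X →ₗ[ℂ] E) (g : Y →ₗ[ℂ] F) (t : X ⊗[ℂ] Y) :
    CProj.comm E F (jmap f g t) = jmap g f (TensorProduct.comm ℂ X Y t) := by
  induction t using TensorProduct.induction_on with
  | zero => simp
  | tmul x y => simp
  | add x y hx hy => simp only [map_add, hx, hy]

theorem assoc_jmap (f : X →ₗ[ℂ] E) (g : Y →ₗ[ℂ] F) (k : Z →ₗ[ℂ] G) (t : (X ⊗[ℂ] Y) ⊗[ℂ] Z) :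
    CProj.assoc E F G (jmap (jmap f g) k t) =
      jmap f (jmap g k) (TensorProduct.assoc ℂ X Y Z t) := by
  induction t using TensorProduct.induction_on with
  | zero => simp
  | add x y hx hy => simp only [map_add, hx, hy]
  | tmul t z =>
    induction t using TensorProduct.induction_on with
    | zero => simp
    | tmul x y => simp
    | add x y hx hy => simp only [map_add, TensorProduct.add_tmul, hx, hy]

theorem assocInv_jmap (f : X →ₗ[ℂ] E) (g : Y →ₗ[ℂ] F) (k : Z →ₗ[ℂ] G)
    (t : X ⊗[ℂ] (Y ⊗[ℂ] Z)) :
    CProj.assocInv E F G (jmap f (jmap g k) t) =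
      jmap (jmap f g) k ((TensorProduct.assoc ℂ X Y Z).symm t) := by
  induction t using TensorProduct.induction_on with
  | zero => simp
  | add x y hx hy => simp only [map_add, hx, hy]
  | tmul x t =>
    induction t using TensorProduct.induction_on with
    | zero => simp
    | tmul x y => simp
    | add x y hx hy => simp only [map_add, TensorProduct.tmul_add, hx, hy]

theorem denseRange_jmap (f : X →ₗ[ℂ] E) (g : Y →ₗ[ℂ] F) (hf : DenseRange f) (hg : DenseRange g) :
    DenseRange (jmap f g) := by
  have h1 : ∀ x y, ctmul E F x y ∈ (LinearMap.range (jmap f g)).topologicalClosure := by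
    intro x y
    have hm : Set.MapsTo (fun z : E × F => ctmul E F z.1 z.2) (Set.range (Prod.map f g))
        (LinearMap.range (jmap f g)) := by
      rintro _ ⟨⟨a, b⟩, rfl⟩
      exact ⟨a ⊗ₜ b, rfl⟩
    have := map_mem_closure (continuous_ctmul (E := E) (F := F)) (hf.prodMap hg (x, y)) hm
    exact this
  have h2 : ∀ u, toCProj E F u ∈ (LinearMap.range (jmap f g)).topologicalClosure := by
    intro u
    induction u using TensorProduct.induction_on with
    | zero => rw [map_zero]; exact zero_mem _
    | tmul x y => exact h1 x y
    | add x y hx hy => rw [map_add]; exact add_mem hx hy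
  have h3 : Dense (closure (Set.range (jmap f g))) :=
    (denseRange_toCProj (E := E) (F := F)).mono (by rintro _ ⟨u, rfl⟩; exact h2 u)
  exact dense_closure.1 h3

end jmap

/-- The map `H → Ĥ ⊗̂ Ĥ` induced by the comultiplication of `H`. -/
def comulAux : SeminormTop (submultSeminorms H) →ₗ[ℂ] CProj (AMEnvelope H) (AMEnvelope H) :=
  jmap (embed (submultSeminorms H)) (embed (submultSeminorms H)) ∘ₗ
    Coalgebra.comul (R := ℂ) ∘ₗ (toSeminormTop (submultSeminorms H)).symm.toLinearMap

theorem continuous_comulAux : Continuous (comulAux H) := by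
  refine (PolynormableSpace.withSeminorms ℂ
    (CProj (AMEnvelope H) (AMEnvelope H))).continuous_of_continuous_comp _ ?_
  rintro ⟨r, hr⟩
  obtain ⟨p, hp, q, hq, h⟩ := exists_bound_of_continuous_bilin
    (ctmul (AMEnvelope H) (AMEnvelope H)) continuous_ctmul hr
  obtain ⟨p', hp', hpp'⟩ := exists_submult_le hp
  obtain ⟨q', hq', hqq'⟩ := exists_submult_le hq
  have hs : (projSeminorm p' q').comp (Coalgebra.comul (R := ℂ)) ∈ submultSeminorms H := by
    intro a b
    simp only [Seminorm.comp_apply, Bialgebra.comul_mul]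
    exact hp'.proj hq' _ _
  refine Seminorm.continuous_of_le
    ((SeminormTop.withSeminorms (submultSeminorms H)).continuous_seminorm ⟨_, hs⟩) fun x => ?_
  have := le_projSeminorm p' q'
    (r.comp (jmap (embed (submultSeminorms H)) (embed (submultSeminorms H)))) zero_le_one
    (fun x y => by
      rw [one_mul]
      exact (h _ _).trans (mul_le_mul (hpp' x) (hqq' y) (apply_nonneg q _) (apply_nonneg p' _)))
    (Coalgebra.comul (R := ℂ) ((toSeminormTop (submultSeminorms H)).symm x))
  rw [one_mul] at this
  exact this

/-- The comultiplication `Ĥ → Ĥ ⊗̂ Ĥ` of the Arens–Michael envelope: the continuous extension of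
the comultiplication of `H`. -/
def comulHat : AMEnvelope H →L[ℂ] CProj (AMEnvelope H) (AMEnvelope H) :=
  ContinuousLinearMap.fromCompletion ⟨comulAux H, continuous_comulAux H⟩

theorem comulHat_coe (h : H) : comulHat H (embed (submultSeminorms H) h) =
    jmap (embed (submultSeminorms H)) (embed (submultSeminorms H))
      (Coalgebra.comul (R := ℂ) h) :=
  ContinuousLinearMap.fromCompletion_apply_coe _ (toSeminormTop (submultSeminorms H) h)

end Comul

/-! ### The action of `Ĥ` on the `H`-completion -/

section Action

variable {H A : Type*} [Ring H] [Algebra ℂ H] [Ring A] [Algebra ℂ A] [Module H A]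
  [IsScalarTower ℂ H A]

/-- The admissible operator bounds of `h : H` with respect to the seminorm `p`. -/
def opBounds (p : Seminorm ℂ A) (h : H) : Set ℝ := {C | 0 ≤ C ∧ ∀ a : A, p (h • a) ≤ C * p a}

theorem opBounds_bddBelow (p : Seminorm ℂ A) (h : H) : BddBelow (opBounds p h) :=
  ⟨0, fun _ hC => hC.1⟩

theorem opBounds_nonempty {p : Seminorm ℂ A} (hp : IsStable H A p) (h : H) :
    (opBounds p h).Nonempty := by
  obtain ⟨C, hC, hC'⟩ := hp h
  exact ⟨C, hC.le, hC'⟩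

theorem opBounds_sInf_nonneg (p : Seminorm ℂ A) (h : H) : 0 ≤ sInf (opBounds p h) :=
  Real.sInf_nonneg fun _ hC => hC.1

theorem le_opBounds_sInf {p : Seminorm ℂ A} (hp : IsStable H A p) (h : H) (a : A) :
    p (h • a) ≤ sInf (opBounds p h) * p a := by
  rcases (apply_nonneg p a).eq_or_lt with ha | ha
  · obtain ⟨C, -, hC⟩ := opBounds_nonempty hp h
    have := hC a
    rw [← ha, mul_zero] at this ⊢
    exact this
  · rw [← div_le_iff₀ ha]
    refine le_csInf (opBounds_nonempty hp h) fun C hC => ?_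
    rw [div_le_iff₀ ha]
    exact hC.2 a

/-- The operator seminorm on `H` induced by an `H`-stable seminorm on `A`. -/
def opSeminorm (p : Seminorm ℂ A) (hp : IsStable H A p) : Seminorm ℂ H :=
  Seminorm.ofSMulLE (fun h => sInf (opBounds p h))
    (le_antisymm (csInf_le (opBounds_bddBelow p 0) ⟨le_rfl, fun a => by simp⟩)
      (opBounds_sInf_nonneg p 0))
    (fun h k => csInf_le (opBounds_bddBelow p _)
      ⟨add_nonneg (opBounds_sInf_nonneg p h) (opBounds_sInf_nonneg p k), fun a => by
        rw [add_smul, add_mul]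
        exact (map_add_le_add p _ _).trans
          (add_le_add (le_opBounds_sInf hp h a) (le_opBounds_sInf hp k a))⟩)
    (fun c h => csInf_le (opBounds_bddBelow p _)
      ⟨mul_nonneg (norm_nonneg c) (opBounds_sInf_nonneg p h), fun a => by
        rw [smul_assoc, map_smul_eq_mul, mul_assoc]
        exact mul_le_mul_of_nonneg_left (le_opBounds_sInf hp h a) (norm_nonneg c)⟩)

theorem opSeminorm_submult (p : Seminorm ℂ A) (hp : IsStable H A p) :
    IsSubmultiplicative (opSeminorm p hp) := fun h k =>
  csInf_le (opBounds_bddBelow p _)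
    ⟨mul_nonneg (opBounds_sInf_nonneg p h) (opBounds_sInf_nonneg p k), fun a => by
      rw [mul_smul, mul_assoc]
      exact (le_opBounds_sInf hp h _).trans
        (mul_le_mul_of_nonneg_left (le_opBounds_sInf hp k a) (opBounds_sInf_nonneg p h))⟩

end Action

section ActionHat

variable (H A : Type*) [Ring H] [Bialgebra ℂ H] [Ring A] [Algebra ℂ A] [Module H A]
  [IsScalarTower ℂ H A]

/-- The action of `H` on `A`, with values in the `H`-completion of `A`. -/
def actionAux : SeminormTop (submultSeminorms H) →ₗ[ℂ] SeminormTop (stableSeminorms H A) →ₗ[ℂ]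
    HCompletion H A :=
  ((actionBilin H A).compl₁₂ (toSeminormTop (submultSeminorms H)).symm.toLinearMap
    (toSeminormTop (stableSeminorms H A)).symm.toLinearMap).compr₂
    (embed (stableSeminorms H A))

theorem continuous_actionAux : Continuous
    fun z : SeminormTop (submultSeminorms H) × SeminormTop (stableSeminorms H A) =>
      actionAux H A z.1 z.2 := by
  have h : Continuous
      fun z : SeminormTop (submultSeminorms H) × SeminormTop (stableSeminorms H A) =>
      (((actionBilin H A).compl₁₂ (toSeminormTop (submultSeminorms H)).symm.toLinearMap
        (toSeminormTop (stableSeminorms H A)).symm.toLinearMap).compr₂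
        (toSeminormTop (stableSeminorms H A)).toLinearMap) z.1 z.2 := by
    refine continuous_bilin_of_bound (SeminormTop.withSeminorms (stableSeminorms H A)) _ ?_
    rintro ⟨p, hp⟩
    refine ⟨_, (SeminormTop.withSeminorms (submultSeminorms H)).continuous_seminorm
      ⟨opSeminorm p hp.1, opSeminorm_submult p hp.1⟩, _,
      (SeminormTop.withSeminorms (stableSeminorms H A)).continuous_seminorm ⟨p, hp⟩,
      fun h a => le_opBounds_sInf hp.1 _ _⟩
  exact (Completion.continuous_coe (SeminormTop (stableSeminorms H A))).comp h

/-- The action `Ĥ ⊗̂ Ã → Ã`: the continuous extension of the action of `H` on `A`. -/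
def actionHat : CProj (AMEnvelope H) (HCompletion H A) →L[ℂ] HCompletion H A :=
  CProj.lift (extendBilin (actionAux H A) (continuous_actionAux H A))
    (continuous_extendBilin (actionAux H A) (continuous_actionAux H A))

theorem actionHat_coe (h : H) (a : A) :
    actionHat H A (ctmul _ _ (embed (submultSeminorms H) h) (embed (stableSeminorms H A) a)) =
      embed (stableSeminorms H A) (h • a) :=
  (CProj.lift_ctmul _ _ _ _).trans
    (extendBilin_coe (actionAux H A) (continuous_actionAux H A)
      (toSeminormTop (submultSeminorms H) h) (toSeminormTop (stableSeminorms H A) a))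

end ActionHat

/-! ### The analytic smash product -/

section BilinOf

variable {E : Type*} [AddCommGroup E] [Module ℂ E] [UniformSpace E] [IsUniformAddGroup E]
  [UniformContinuousConstSMul ℂ E] [PolynormableSpace ℂ E]

/-- The bilinear map `E × E → E` that corresponds to a continuous linear map `E ⊗̂ E → E`. -/
def bilinOf (m : CProj E E →L[ℂ] E) : E →ₗ[ℂ] E →ₗ[ℂ] E := (ctmul E E).compr₂ m.toLinearMap

theorem bilinOf_apply (m : CProj E E →L[ℂ] E) (x y : E) : bilinOf m x y = m (ctmul E E x y) := rfl

theorem continuous_bilinOf (m : CProj E E →L[ℂ] E) :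
    Continuous fun z : E × E => bilinOf m z.1 z.2 :=
  m.continuous.comp continuous_ctmul

end BilinOf

section AnalyticSmashMul

variable {A H : Type*}
  [AddCommGroup H] [Module ℂ H] [UniformSpace H] [IsUniformAddGroup H]
  [UniformContinuousConstSMul ℂ H] [PolynormableSpace ℂ H]
  [AddCommGroup A] [Module ℂ A] [UniformSpace A] [IsUniformAddGroup A]
  [UniformContinuousConstSMul ℂ A] [PolynormableSpace ℂ A]

/-- The map `τ : H ⊗̂ A → A ⊗̂ H` given by a comultiplication `Δ` and an action `act`, as the
composition `H ⊗̂ A → (H ⊗̂ H) ⊗̂ A → H ⊗̂ (H ⊗̂ A) → H ⊗̂ (A ⊗̂ H) → (H ⊗̂ A) ⊗̂ H → A ⊗̂ H`. -/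
def analyticTau (Δ : H →L[ℂ] CProj H H) (act : CProj H A →L[ℂ] A) : CProj H A →L[ℂ] CProj A H :=
  CProj.map act (ContinuousLinearMap.id ℂ H) ∘L
  CProj.assocInv H A H ∘L
  CProj.map (ContinuousLinearMap.id ℂ H) (CProj.comm H A) ∘L
  CProj.assoc H H A ∘L
  CProj.map Δ (ContinuousLinearMap.id ℂ A)

/-- The map `id ⊗̂ μ_H` preceded by `τ ⊗̂ id`: `H ⊗̂ (A ⊗̂ H) → A ⊗̂ H`. -/
def analyticInner (Δ : H →L[ℂ] CProj H H) (μH : CProj H H →L[ℂ] H) (act : CProj H A →L[ℂ] A) :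
    CProj H (CProj A H) →L[ℂ] CProj A H :=
  CProj.map (ContinuousLinearMap.id ℂ A) μH ∘L
  CProj.assoc A H H ∘L
  CProj.map (analyticTau Δ act) (ContinuousLinearMap.id ℂ H) ∘L
  CProj.assocInv H A H

/-- The multiplication of the analytic smash product,
`(μ_A ⊗̂ μ_H) ∘ (id_A ⊗̂ τ ⊗̂ id_H) : (A ⊗̂ H) ⊗̂ (A ⊗̂ H) → A ⊗̂ H`. -/
def analyticSmashMul (Δ : H →L[ℂ] CProj H H) (μH : CProj H H →L[ℂ] H) (μA : CProj A A →L[ℂ] A)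
    (act : CProj H A →L[ℂ] A) : CProj (CProj A H) (CProj A H) →L[ℂ] CProj A H :=
  CProj.map μA (ContinuousLinearMap.id ℂ H) ∘L
  CProj.assocInv A A H ∘L
  CProj.map (ContinuousLinearMap.id ℂ A) (analyticInner Δ μH act) ∘L
  CProj.assoc A H (CProj A H)

theorem analyticSmashMul_jmap {X Y : Type*} [AddCommGroup X] [Module ℂ X] [AddCommGroup Y]
    [Module ℂ Y] (Δ : H →L[ℂ] CProj H H) (μH : CProj H H →L[ℂ] H) (μA : CProj A A →L[ℂ] A)
    (act : CProj H A →L[ℂ] A) (f : X →ₗ[ℂ] A) (g : Y →ₗ[ℂ] H) (mA : X ⊗[ℂ] X →ₗ[ℂ] X)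
    (inner : Y ⊗[ℂ] (X ⊗[ℂ] Y) →ₗ[ℂ] X ⊗[ℂ] Y)
    (hA : ∀ t, μA (jmap f f t) = f (mA t))
    (hi : ∀ t, analyticInner Δ μH act (jmap g (jmap f g) t) = jmap f g (inner t))
    (t : (X ⊗[ℂ] Y) ⊗[ℂ] (X ⊗[ℂ] Y)) :
    analyticSmashMul Δ μH μA act (jmap (jmap f g) (jmap f g) t) =
      jmap f g (TensorProduct.map mA LinearMap.id ((TensorProduct.assoc ℂ X X Y).symm
        (TensorProduct.map LinearMap.id inner (TensorProduct.assoc ℂ X Y (X ⊗[ℂ] Y) t)))) := by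
  simp only [analyticSmashMul, ContinuousLinearMap.comp_apply]
  rw [assoc_jmap f g (jmap f g) t, map_id_jmap f _ (analyticInner Δ μH act) (jmap f g) inner hi,
    assocInv_jmap, map_jmap_id _ _ μA f mA hA]

end AnalyticSmashMul

section AnalyticSmash

variable (A H : Type*) [Ring H] [Bialgebra ℂ H] [Ring A] [Algebra ℂ A] [Module H A]
  [IsScalarTower ℂ H A]

/-- The map `A ⊗ H → Ã ⊗̂ Ĥ`. -/
def toHatTensor : A ⊗[ℂ] H →ₗ[ℂ] CProj (HCompletion H A) (AMEnvelope H) :=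
  jmap (embed (stableSeminorms H A)) (embed (submultSeminorms H))

theorem denseRange_toHatTensor : DenseRange (toHatTensor A H) :=
  denseRange_jmap _ _ (denseRange_embed _) (denseRange_embed _)

variable {H} in
theorem completionMul_jmap (P : Set (Seminorm ℂ A)) [IsSubmultFamily P] (t : A ⊗[ℂ] A) :
    completionMul P (jmap (embed P)
      (embed P) t) =
      embed P (LinearMap.mul' ℂ A t) := by
  induction t using TensorProduct.induction_on with
  | zero => simp
  | add x y hx hy => simp only [map_add, hx, hy]
  | tmul a b =>
    refine (CProj.lift_ctmul _ _ _ _).trans ?_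
    exact (Completion.coe_mul (α := SeminormTop P) (toSeminormTop P a) (toSeminormTop P b)).symm

theorem actionHat_jmap (t : H ⊗[ℂ] A) :
    actionHat H A (jmap (embed (submultSeminorms H)) (embed (stableSeminorms H A)) t) =
      embed (stableSeminorms H A) (TensorProduct.lift (actionBilin H A) t) := by
  induction t using TensorProduct.induction_on with
  | zero => simp
  | add x y hx hy => simp only [map_add, hx, hy]
  | tmul h a => exact actionHat_coe H A h a

theorem analyticTau_jmap (t : H ⊗[ℂ] A) :
    analyticTau (comulHat H) (actionHat H A)
      (jmap (embed (submultSeminorms H)) (embed (stableSeminorms H A)) t) =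
      toHatTensor A H (smashTau H A t) := by
  simp only [analyticTau, smashTau, ContinuousLinearMap.comp_apply, LinearMap.comp_apply,
    LinearEquiv.coe_coe]
  rw [map_jmap_id _ _ (comulHat H)
      (jmap (embed (submultSeminorms H)) (embed (submultSeminorms H))) (Coalgebra.comul (R := ℂ))
      (comulHat_coe H), assoc_jmap,
    map_id_jmap _ _ (CProj.comm (AMEnvelope H) (HCompletion H A))
      (jmap (embed (stableSeminorms H A)) (embed (submultSeminorms H)))
      (TensorProduct.comm ℂ H A).toLinearMap (fun t => comm_jmap _ _ t), assocInv_jmap,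
    map_jmap_id _ _ (actionHat H A) (embed (stableSeminorms H A))
      (TensorProduct.lift (actionBilin H A)) (actionHat_jmap A H)]
  rfl

theorem analyticInner_jmap (t : H ⊗[ℂ] (A ⊗[ℂ] H)) :
    analyticInner (comulHat H) (completionMul (submultSeminorms H)) (actionHat H A)
      (jmap (embed (submultSeminorms H))
        (jmap (embed (stableSeminorms H A)) (embed (submultSeminorms H))) t) =
      jmap (embed (stableSeminorms H A)) (embed (submultSeminorms H)) (smashInner H A t) := by
  simp only [analyticInner, smashInner, ContinuousLinearMap.comp_apply, LinearMap.comp_apply,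
    LinearEquiv.coe_coe]
  rw [assocInv_jmap,
    map_jmap_id _ _ (analyticTau (comulHat H) (actionHat H A))
      (jmap (embed (stableSeminorms H A)) (embed (submultSeminorms H))) (smashTau H A)
      (analyticTau_jmap A H), assoc_jmap,
    map_id_jmap _ _ (completionMul (submultSeminorms H)) (embed (submultSeminorms H))
      (LinearMap.mul' ℂ H) (completionMul_jmap H (submultSeminorms H))]

theorem hatMul_jmap (t : (A ⊗[ℂ] H) ⊗[ℂ] (A ⊗[ℂ] H)) :
    analyticSmashMul (comulHat H) (completionMul (submultSeminorms H))
        (completionMul (stableSeminorms H A)) (actionHat H A)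
        (jmap (jmap (embed (stableSeminorms H A)) (embed (submultSeminorms H)))
          (jmap (embed (stableSeminorms H A)) (embed (submultSeminorms H))) t) =
      jmap (embed (stableSeminorms H A)) (embed (submultSeminorms H)) (smashMul H A t) :=
  analyticSmashMul_jmap (comulHat H) (completionMul (submultSeminorms H))
    (completionMul (stableSeminorms H A)) (actionHat H A) (embed (stableSeminorms H A))
    (embed (submultSeminorms H)) (LinearMap.mul' ℂ A) (smashInner H A)
    (completionMul_jmap A (stableSeminorms H A)) (analyticInner_jmap A H) t

/-- The multiplication of `Ã #̂ Ĥ`, as a continuous linear map. -/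
def hatMul : CProj (CProj (HCompletion H A) (AMEnvelope H))
    (CProj (HCompletion H A) (AMEnvelope H)) →L[ℂ] CProj (HCompletion H A) (AMEnvelope H) :=
  analyticSmashMul (comulHat H) (completionMul (submultSeminorms H))
    (completionMul (stableSeminorms H A)) (actionHat H A)

theorem hatMul_def : hatMul A H = analyticSmashMul (comulHat H)
    (completionMul (submultSeminorms H)) (completionMul (stableSeminorms H A))
    (actionHat H A) := rfl

theorem hatMul_coe (x y : A ⊗[ℂ] H) :
    hatMul A H (ctmul _ _ (toHatTensor A H x) (toHatTensor A H y)) =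
      toHatTensor A H (smashMul H A (x ⊗ₜ y)) :=
  (DFunLike.congr_fun (hatMul_def A H) _).trans (hatMul_jmap A H (x ⊗ₜ y))

/-- The analytic smash product `Ã #̂ Ĥ` of the `H`-completion of `A` and the Arens–Michael envelope
of `H`: the completed projective tensor product `Ã ⊗̂ Ĥ` with the multiplication
`(μ ⊗̂ μ) ∘ (id ⊗̂ τ ⊗̂ id)`. -/
def AnalyticSmash : Type _ := CProj (HCompletion H A) (AMEnvelope H)

instance : AddCommGroup (AnalyticSmash A H) :=
  inferInstanceAs (AddCommGroup (CProj (HCompletion H A) (AMEnvelope H)))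

instance : Module ℂ (AnalyticSmash A H) :=
  inferInstanceAs (Module ℂ (CProj (HCompletion H A) (AMEnvelope H)))

instance : UniformSpace (AnalyticSmash A H) :=
  inferInstanceAs (UniformSpace (CProj (HCompletion H A) (AMEnvelope H)))

instance : IsUniformAddGroup (AnalyticSmash A H) :=
  inferInstanceAs (IsUniformAddGroup (CProj (HCompletion H A) (AMEnvelope H)))

instance : CompleteSpace (AnalyticSmash A H) :=
  inferInstanceAs (CompleteSpace (CProj (HCompletion H A) (AMEnvelope H)))

instance : T0Space (AnalyticSmash A H) :=
  inferInstanceAs (T0Space (CProj (HCompletion H A) (AMEnvelope H)))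

instance : ContinuousSMul ℂ (AnalyticSmash A H) :=
  inferInstanceAs (ContinuousSMul ℂ (CProj (HCompletion H A) (AMEnvelope H)))

instance : PolynormableSpace ℂ (AnalyticSmash A H) :=
  inferInstanceAs (PolynormableSpace ℂ (CProj (HCompletion H A) (AMEnvelope H)))

/-- The multiplication of `Ã #̂ Ĥ` as a bilinear map. -/
def analyticMulBilin : AnalyticSmash A H →ₗ[ℂ] AnalyticSmash A H →ₗ[ℂ] AnalyticSmash A H :=
  bilinOf (hatMul A H)

theorem continuous_analyticMulBilin :
    Continuous fun z : AnalyticSmash A H × AnalyticSmash A H => analyticMulBilin A H z.1 z.2 :=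
  continuous_bilinOf (hatMul A H)

/-- The canonical map `A # H → Ã #̂ Ĥ`, `a ⊗ h ↦ a ⊗ h`, as a linear map. -/
def smashToAnalyticLinear : SmashProduct A H →ₗ[ℂ] AnalyticSmash A H :=
  toHatTensor A H ∘ₗ (toSmash A H).symm.toLinearMap

theorem denseRange_smashToAnalyticLinear : DenseRange (smashToAnalyticLinear A H) :=
  denseRange_toHatTensor A H

theorem analyticMulBilin_coe (x y : SmashProduct A H) :
    analyticMulBilin A H (smashToAnalyticLinear A H x) (smashToAnalyticLinear A H y) =
      smashToAnalyticLinear A H (x * y) :=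
  (bilinOf_apply (hatMul A H) _ _).trans
    (hatMul_coe A H ((toSmash A H).symm x) ((toSmash A H).symm y))

instance : Mul (AnalyticSmash A H) := ⟨fun x y => analyticMulBilin A H x y⟩

instance : One (AnalyticSmash A H) := ⟨smashToAnalyticLinear A H 1⟩

theorem AnalyticSmash.mul_def (x y : AnalyticSmash A H) : x * y = analyticMulBilin A H x y := rfl

theorem AnalyticSmash.one_def : (1 : AnalyticSmash A H) = smashToAnalyticLinear A H 1 := rfl

instance : ContinuousMul (AnalyticSmash A H) := ⟨continuous_analyticMulBilin A H⟩

theorem smashToAnalyticLinear_mul (x y : SmashProduct A H) :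
    smashToAnalyticLinear A H (x * y) = smashToAnalyticLinear A H x * smashToAnalyticLinear A H y :=
  (analyticMulBilin_coe A H x y).symm

variable [IsModuleAlgebra H A]

instance : Ring (AnalyticSmash A H) :=
  { (inferInstance : AddCommGroup (AnalyticSmash A H)),
    (inferInstance : Mul (AnalyticSmash A H)), (inferInstance : One (AnalyticSmash A H)) with
    left_distrib := fun x y z => by simp only [AnalyticSmash.mul_def, map_add]
    right_distrib := fun x y z => by
      simp only [AnalyticSmash.mul_def, map_add, LinearMap.add_apply]
    zero_mul := fun x => by simp [AnalyticSmash.mul_def]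
    mul_zero := fun x => by simp [AnalyticSmash.mul_def]
    mul_assoc := fun x y z => by
      refine (denseRange_smashToAnalyticLinear A H).induction_on₃
        (p := fun x y z => x * y * z = x * (y * z)) ?_ ?_ x y z
      · exact isClosed_eq
          ((continuous_fst.mul (continuous_fst.comp continuous_snd)).mul
            (continuous_snd.comp continuous_snd))
          (continuous_fst.mul ((continuous_fst.comp continuous_snd).mul
            (continuous_snd.comp continuous_snd)))
      · intro a b c
        simp only [← smashToAnalyticLinear_mul, mul_assoc]
    one_mul := fun x => by
      refine (denseRange_smashToAnalyticLinear A H).induction_on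
        (p := fun x => 1 * x = x) x ?_ ?_
      · exact isClosed_eq (continuous_const.mul continuous_id) continuous_id
      · intro a
        rw [AnalyticSmash.one_def, ← smashToAnalyticLinear_mul, one_mul]
    mul_one := fun x => by
      refine (denseRange_smashToAnalyticLinear A H).induction_on
        (p := fun x => x * 1 = x) x ?_ ?_
      · exact isClosed_eq (continuous_id.mul continuous_const) continuous_id
      · intro a
        rw [AnalyticSmash.one_def, ← smashToAnalyticLinear_mul, mul_one] }

instance : Algebra ℂ (AnalyticSmash A H) :=
  Algebra.ofModule
    (fun c x y => by simp only [AnalyticSmash.mul_def, map_smul, LinearMap.smul_apply])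
    (fun c x y => by simp only [AnalyticSmash.mul_def, map_smul])

instance : IsTopologicalRing (AnalyticSmash A H) where
  continuous_add := continuous_add
  continuous_neg := continuous_neg

/-- The canonical homomorphism `A # H → Ã #̂ Ĥ`, `a ⊗ h ↦ a ⊗ h`. -/
def smashToAnalytic : SmashProduct A H →ₐ[ℂ] AnalyticSmash A H :=
  AlgHom.ofLinearMap (smashToAnalyticLinear A H) rfl (smashToAnalyticLinear_mul A H)

/-- The canonical homomorphism is given by `a ⊗ h ↦ a ⊗ h`. -/
theorem smashToAnalytic_tmul (a : A) (h : H) :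
    smashToAnalytic A H (toSmash A H (a ⊗ₜ h)) =
      ctmul _ _ (toHCompletion H A a) (toAMEnvelope H h) := rfl

end AnalyticSmash

end ArensMichael

end

/-!
A submultiplicative seminorm `r` on `A # H` satisfies `r (a ⊗ h) ≤ r (a ⊗ 1) * r (1 ⊗ h)`, and its
restriction to `A` is `H`-stable because the action is inner in `A # H`:
`h • a = ∑ h₍₁₎ a S(h₍₂₎)`. Conversely, if `p` is stable and submultiplicative on `A` and `q` is
submultiplicative on `H`, then left multiplications are bounded for `p ⊗ q`, so `p ⊗ q` is at most
a multiple of the operator seminorm of the left regular representation, which is submultiplicative.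
Hence the two families of seminorms define the same topology on `A ⊗ H`, and both algebras are its
completion.
-/

noncomputable section

namespace ArensMichael

section Completion

variable {E F G : Type*} [AddCommGroup E] [Module ℂ E] [AddCommGroup F] [Module ℂ F]
  {P : Set (Seminorm ℂ E)} {Q : Set (Seminorm ℂ F)}

/-- The family `P` dominates its completion if every continuous seminorm on the completion is
bounded on `E` by a single member of `P`, with no constant and no finite supremum. -/
def IsDominating (P : Set (Seminorm ℂ E)) : Prop :=
  ∀ r : Seminorm ℂ (SeminormCompletion P), Continuous r → ∃ p ∈ P, ∀ x, r (embed P x) ≤ p x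

theorem IsDominating.of_sup_of_smul (hbot : ⊥ ∈ P) (hsup : SupClosed P)
    (hsmul : ∀ p ∈ P, ∀ C : ℝ≥0, 1 ≤ C → C • p ∈ P) : IsDominating P := by
  intro r hr
  obtain ⟨s, C, -, hle⟩ := Seminorm.bound_of_continuous (SeminormTop.withSeminorms P)
    (r.comp (toComplL (SeminormTop P)).toLinearMap) (hr.comp (toComplL (SeminormTop P)).continuous)
  have hs : s.sup (fun p : P => p.1) ∈ P :=
    Finset.sup_induction hbot (fun _ hp _ hq => hsup hp hq) fun p _ => p.2
  have hC : C • s.sup (fun p : P => p.1) ≤ max 1 C • s.sup (fun p : P => p.1) := fun x =>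
    mul_le_mul_of_nonneg_right (NNReal.coe_le_coe.2 (le_max_right 1 C)) (apply_nonneg _ x)
  exact ⟨_, hsmul _ hs _ (le_max_left 1 C), fun x => (hle (toSeminormTop P x)).trans (hC x)⟩

variable [AddCommGroup G] [Module ℂ G] [UniformSpace G] [PolynormableSpace ℂ G]

theorem SeminormTop.continuous_of_bound (f : E →ₗ[ℂ] G)
    (hf : ∀ r : Seminorm ℂ G, Continuous r → ∃ p ∈ P, ∃ C : ℝ≥0, ∀ x, r (f x) ≤ C * p x) :
    Continuous (f ∘ₗ (toSeminormTop P).symm.toLinearMap) := by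
  refine (PolynormableSpace.withSeminorms ℂ G).continuous_of_continuous_comp _ ?_
  rintro ⟨r, hr⟩
  obtain ⟨p, hp, C, hle⟩ := hf r hr
  have hcont : Continuous (C • SeminormTop.seminorm P ⟨p, hp⟩) :=
    ((SeminormTop.withSeminorms P).continuous_seminorm ⟨p, hp⟩).const_smul C
  exact Seminorm.continuous_of_le hcont fun x => hle ((toSeminormTop P).symm x)

variable [IsUniformAddGroup G] [UniformContinuousConstSMul ℂ G]

theorem continuous_bilin_seminormTop (b : E →ₗ[ℂ] F →ₗ[ℂ] G)
    (hb : ∀ r : Seminorm ℂ G, Continuous r →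
      ∃ p ∈ P, ∃ q ∈ Q, ∀ x y, r (b x y) ≤ p x * q y) :
    Continuous fun z : SeminormTop P × SeminormTop Q =>
      b.compl₁₂ (toSeminormTop P).symm.toLinearMap (toSeminormTop Q).symm.toLinearMap z.1 z.2 := by
  refine continuous_bilin_of_bound (PolynormableSpace.withSeminorms ℂ G) _ ?_
  rintro ⟨r, hr⟩
  obtain ⟨p, hp, q, hq, hle⟩ := hb r hr
  exact ⟨_, (SeminormTop.withSeminorms P).continuous_seminorm ⟨p, hp⟩,
    _, (SeminormTop.withSeminorms Q).continuous_seminorm ⟨q, hq⟩, fun _ _ => hle _ _⟩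

theorem exists_comp_jmap_le (hP : IsDominating P) (hQ : IsDominating Q)
    {r : Seminorm ℂ (CProj (SeminormCompletion P) (SeminormCompletion Q))} (hr : Continuous r) :
    ∃ p ∈ P, ∃ q ∈ Q, ∀ t, r (jmap (embed P) (embed Q) t) ≤ projSeminorm p q t := by
  obtain ⟨p, hp, q, hq, hpq⟩ := exists_bound_of_continuous_bilin
    (ctmul (SeminormCompletion P) (SeminormCompletion Q)) continuous_ctmul hr
  obtain ⟨p', hp', hpp'⟩ := hP p hp
  obtain ⟨q', hq', hqq'⟩ := hQ q hq
  refine ⟨p', hp', q', hq', fun t => ?_⟩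
  have htmul (x : E) (y : F) :
      r.comp (jmap (embed P) (embed Q)) (x ⊗ₜ y) ≤ 1 * (p' x * q' y) := by
    rw [one_mul]
    exact (hpq _ _).trans
      (mul_le_mul (hpp' x) (hqq' y) (apply_nonneg q _) (apply_nonneg p' x))
  exact (le_projSeminorm p' q' (r.comp (jmap (embed P) (embed Q))) zero_le_one htmul t).trans_eq
    (one_mul _)

variable [T0Space G] [CompleteSpace G]

/-- The continuous extension to the completion of a linear map that is bounded with respect to the
family `P`. -/
def SeminormCompletion.lift (f : E →ₗ[ℂ] G)
    (hf : ∀ r : Seminorm ℂ G, Continuous r → ∃ p ∈ P, ∃ C : ℝ≥0, ∀ x, r (f x) ≤ C * p x) :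
    SeminormCompletion P →L[ℂ] G :=
  ContinuousLinearMap.fromCompletion ⟨_, SeminormTop.continuous_of_bound f hf⟩

theorem SeminormCompletion.lift_embed (f : E →ₗ[ℂ] G)
    (hf : ∀ r : Seminorm ℂ G, Continuous r → ∃ p ∈ P, ∃ C : ℝ≥0, ∀ x, r (f x) ≤ C * p x) (x : E) :
    SeminormCompletion.lift f hf (embed P x) = f x :=
  ContinuousLinearMap.fromCompletion_apply_coe _ (toSeminormTop P x)

/-- The continuous linear map on the completed projective tensor product of two completions induced
by a bilinear map that is bounded with respect to the families `P` and `Q`. -/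
def CProj.liftOfBound (b : E →ₗ[ℂ] F →ₗ[ℂ] G)
    (hb : ∀ r : Seminorm ℂ G, Continuous r →
      ∃ p ∈ P, ∃ q ∈ Q, ∀ x y, r (b x y) ≤ p x * q y) :
    CProj (SeminormCompletion P) (SeminormCompletion Q) →L[ℂ] G :=
  CProj.lift (extendBilin _ (continuous_bilin_seminormTop b hb))
    (continuous_extendBilin _ (continuous_bilin_seminormTop b hb))

theorem CProj.liftOfBound_jmap (b : E →ₗ[ℂ] F →ₗ[ℂ] G)
    (hb : ∀ r : Seminorm ℂ G, Continuous r →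
      ∃ p ∈ P, ∃ q ∈ Q, ∀ x y, r (b x y) ≤ p x * q y) (t : E ⊗[ℂ] F) :
    CProj.liftOfBound b hb (jmap (embed P) (embed Q) t) = TensorProduct.lift b t := by
  suffices h : (CProj.liftOfBound b hb).toLinearMap ∘ₗ jmap (embed P) (embed Q) =
      TensorProduct.lift b from DFunLike.congr_fun h t
  refine TensorProduct.ext' fun x y => ?_
  exact (CProj.lift_ctmul (extendBilin _ (continuous_bilin_seminormTop b hb))
      (continuous_extendBilin _ (continuous_bilin_seminormTop b hb)) _ _).trans
    (extendBilin_coe _ (continuous_bilin_seminormTop b hb) (toSeminormTop P x) (toSeminormTop Q y))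

end Completion

theorem bilin_le_projSeminorm_mul_projSeminorm {E F E' F' G : Type*}
    [AddCommGroup E] [Module ℂ E] [AddCommGroup F] [Module ℂ F]
    [AddCommGroup E'] [Module ℂ E'] [AddCommGroup F'] [Module ℂ F']
    [AddCommGroup G] [Module ℂ G] {p : Seminorm ℂ E} {q : Seminorm ℂ F} {p' : Seminorm ℂ E'}
    {q' : Seminorm ℂ F'} {r : Seminorm ℂ G} (b : E ⊗[ℂ] F →ₗ[ℂ] E' ⊗[ℂ] F' →ₗ[ℂ] G)
    (hb : ∀ x y x' y', r (b (x ⊗ₜ y) (x' ⊗ₜ y')) ≤ p x * q y * (p' x' * q' y'))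
    (t : E ⊗[ℂ] F) (t' : E' ⊗[ℂ] F') :
    r (b t t') ≤ projSeminorm p q t * projSeminorm p' q' t' := by
  have hleft (x : E) (y : F) : r (b (x ⊗ₜ y) t') ≤ p x * q y * projSeminorm p' q' t' :=
    le_projSeminorm p' q' (r.comp (b (x ⊗ₜ y)))
      (mul_nonneg (apply_nonneg p x) (apply_nonneg q y)) (hb x y) t'
  rw [mul_comm]
  exact le_projSeminorm p q (r.comp (b.flip t')) (apply_nonneg _ t')
    (fun x y => (hleft x y).trans_eq (mul_comm _ _)) t

section Algebra

/-- The isomorphism of two Hausdorff topological algebras in which the same algebra `X` has dense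
image, obtained from continuous linear maps that are compatible with the maps from `X`. -/
def continuousAlgEquivOfDenseRange {R X B C : Type*} [CommSemiring R] [Semiring X] [Algebra R X]
    [Semiring B] [Algebra R B] [TopologicalSpace B] [ContinuousMul B] [T2Space B]
    [Semiring C] [Algebra R C] [TopologicalSpace C] [ContinuousMul C] [T2Space C]
    {i : X →ₐ[R] B} {j : X →ₐ[R] C} (hi : DenseRange i) (hj : DenseRange j)
    (f : B →L[R] C) (g : C →L[R] B) (hf : ∀ x, f (i x) = j x) (hg : ∀ x, g (j x) = i x) :
    B ≃A[R] C where
  toFun := f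
  invFun := g
  left_inv := congrFun <| hi.equalizer (g.continuous.comp f.continuous) continuous_id <|
    funext fun x => by simp only [Function.comp_apply, hf, hg]
  right_inv := congrFun <| hj.equalizer (f.continuous.comp g.continuous) continuous_id <|
    funext fun x => by simp only [Function.comp_apply, hf, hg]
  map_mul' x y := by
    induction x, y using hi.induction_on₂ with
    | hp => exact isClosed_eq (by fun_prop) (by fun_prop)
    | h x y => rw [← map_mul, hf, hf, hf, map_mul]
  map_add' := map_add f
  commutes' c := by rw [← i.commutes, hf, j.commutes]
  continuous_toFun := f.continuous
  continuous_invFun := g.continuous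

variable {A B : Type*} [Ring A] [Algebra ℂ A] [Ring B] [Algebra ℂ B]

theorem isDominating_submultSeminorms : IsDominating (submultSeminorms A) :=
  fun _ hr => exists_submult_le hr

theorem IsSubmultiplicative.comp_algHom {r : Seminorm ℂ B} (hr : IsSubmultiplicative r)
    (f : A →ₐ[ℂ] B) : IsSubmultiplicative (r.comp f.toLinearMap) := fun a b => by
  simpa only [Seminorm.comp_apply, AlgHom.toLinearMap_apply, map_mul] using hr (f a) (f b)

theorem IsSubmultiplicative.sum_mul_mul_le {r : Seminorm ℂ B} (hr : IsSubmultiplicative r)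
    {ι : Type*} (s : Finset ι) (u v : ι → B) (x : B) :
    r (∑ i ∈ s, u i * x * v i) ≤ (∑ i ∈ s, r (u i) * r (v i)) * r x := by
  rw [Finset.sum_mul]
  refine (Finset.le_sum_of_subadditive _ (map_zero r).le (map_add_le_add r) _ _).trans
    (Finset.sum_le_sum fun i _ => ?_)
  calc r (u i * x * v i) ≤ r (u i) * r x * r (v i) :=
        (hr _ _).trans (mul_le_mul_of_nonneg_right (hr _ _) (apply_nonneg r _))
    _ = r (u i) * r (v i) * r x := by ring

end Algebra

section Stable

variable {H A : Type*} [Ring H] [Ring A] [Algebra ℂ A] [Module H A]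
  {p q : Seminorm ℂ A}

theorem IsStable.of_bound (hp : ∀ h : H, ∃ C : ℝ, ∀ a, p (h • a) ≤ C * p a) : IsStable H A p := by
  intro h
  obtain ⟨C, hC⟩ := hp h
  exact ⟨max C 1, lt_max_of_lt_right one_pos, fun a =>
    (hC a).trans (mul_le_mul_of_nonneg_right (le_max_left C 1) (apply_nonneg p a))⟩

variable (H A) in
theorem IsStable.bot : IsStable H A ⊥ :=
  .of_bound fun _ => ⟨0, fun _ => by simp⟩

theorem IsStable.sup (hp : IsStable H A p) (hq : IsStable H A q) : IsStable H A (p ⊔ q) := by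
  refine .of_bound fun h => ?_
  obtain ⟨C, hC, hCp⟩ := hp h
  obtain ⟨D, -, hDq⟩ := hq h
  refine ⟨max C D, fun a => sup_le ((hCp a).trans ?_) ((hDq a).trans ?_)⟩ <;>
    gcongr
  exacts [le_max_left C D, le_sup_left (a := p a), le_max_right C D, le_sup_right (b := q a)]

theorem IsStable.smul (hp : IsStable H A p) (C : ℝ≥0) : IsStable H A (C • p) := by
  intro h
  obtain ⟨D, hD, hle⟩ := hp h
  refine ⟨D, hD, fun a => ?_⟩
  calc (C : ℝ) * p (h • a) ≤ C * (D * p a) := mul_le_mul_of_nonneg_left (hle a) C.2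
    _ = D * (C * p a) := mul_left_comm _ _ _

variable (H A) in
theorem isDominating_stableSeminorms : IsDominating (stableSeminorms H A) :=
  .of_sup_of_smul ⟨.bot H A, fun _ _ => by simp⟩ (fun _ hp _ hq => ⟨hp.1.sup hq.1, hp.2.sup hq.2⟩)
    fun _ hp _ hC => ⟨hp.1.smul _, hp.2.smul hC⟩

/-- The submultiplicative seminorm is the operator seminorm of the left regular representation,
and the constant is `p 1`. -/
theorem IsStable.exists_submult_le (hp : IsStable A A p) :
    ∃ s ∈ submultSeminorms A, ∃ C : ℝ≥0, ∀ a, p a ≤ C * s a := by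
  refine ⟨opSeminorm p hp, opSeminorm_submult p hp, ⟨p 1, apply_nonneg p 1⟩, fun a => ?_⟩
  have hle : p (a • 1) ≤ opSeminorm p hp a * p 1 := le_opBounds_sInf hp a 1
  rwa [smul_eq_mul, mul_one, mul_comm] at hle

end Stable

theorem sum_comul_mul_antipode {R H ι : Type*} [CommSemiring R] [Semiring H] [HopfAlgebra R H]
    {h : H} (r : Coalgebra.Repr R h ι) :
    ∑ i ∈ r.index, Coalgebra.comul (r.left i) *
      (1 ⊗ₜ HopfAlgebraStruct.antipode R (r.right i)) = h ⊗ₜ[R] 1 := by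
  let r₁ := fun i => Coalgebra.Repr.arbitrary R (r.left i)
  let r₂ := fun i => Coalgebra.Repr.arbitrary R (r.right i)
  let mulAntipode : H ⊗[R] H →ₗ[R] H :=
    LinearMap.mul' R H ∘ₗ LinearMap.lTensor H (HopfAlgebraStruct.antipode R)
  have hcoassoc := congrArg (LinearMap.lTensor H mulAntipode)
    (Coalgebra.sum_tmul_tmul_eq r r₁ r₂)
  calc ∑ i ∈ r.index, Coalgebra.comul (r.left i) *
        (1 ⊗ₜ[R] HopfAlgebraStruct.antipode R (r.right i))
      = ∑ i ∈ r.index, ∑ j ∈ (r₁ i).index, (r₁ i).left j ⊗ₜ[R]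
          ((r₁ i).right j * HopfAlgebraStruct.antipode R (r.right i)) := by
        simp only [← (r₁ _).eq, Finset.sum_mul, Algebra.TensorProduct.tmul_mul_tmul, mul_one]
    _ = ∑ i ∈ r.index, ∑ j ∈ (r₂ i).index, r.left i ⊗ₜ[R]
          ((r₂ i).left j * HopfAlgebraStruct.antipode R ((r₂ i).right j)) := by
        simpa only [map_sum, LinearMap.lTensor_tmul, mulAntipode, LinearMap.comp_apply,
          LinearMap.mul'_apply] using hcoassoc
    _ = ∑ i ∈ r.index, r.left i ⊗ₜ[R] algebraMap R H (Coalgebra.counit (r.right i)) := by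
        simp only [← TensorProduct.tmul_sum, HopfAlgebra.sum_mul_antipode_eq_algebraMap_counit]
    _ = h ⊗ₜ[R] 1 := by
        simpa only [map_sum, LinearMap.lTensor_tmul, Algebra.linearMap_apply, map_one] using
          congrArg (LinearMap.lTensor H (Algebra.linearMap R H)) (Coalgebra.sum_tmul_counit_eq r)

section SmashProduct

variable {A H : Type*} [Ring H] [Ring A] [Algebra ℂ A] [Module H A]

section Bialgebra

variable [Bialgebra ℂ H] [IsScalarTower ℂ H A]

theorem SmashProduct.tmul_mul_tmul (a b : A) (h k : H) :
    toSmash A H (a ⊗ₜ h) * toSmash A H (b ⊗ₜ k) =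
      toSmash A H (TensorProduct.map (LinearMap.mulLeft ℂ a ∘ₗ (actionBilin H A).flip b)
        (LinearMap.mulRight ℂ k) (Coalgebra.comul (R := ℂ) h)) := by
  let r := Coalgebra.Repr.arbitrary ℂ h
  rw [mul_def, LinearEquiv.symm_apply_apply, LinearEquiv.symm_apply_apply,
    smashMul_tmul a b h k r, ← r.eq, map_sum (TensorProduct.map _ _)]
  rfl

theorem SmashProduct.tmul_one_mul_tmul (a b : A) (k : H) :
    toSmash A H (a ⊗ₜ 1) * toSmash A H (b ⊗ₜ k) = toSmash A H ((a * b) ⊗ₜ k) := by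
  rw [tmul_mul_tmul, Bialgebra.comul_one, Algebra.TensorProduct.one_def, TensorProduct.map_tmul]
  simp only [LinearMap.comp_apply, LinearMap.flip_apply, actionBilin_apply, one_smul,
    LinearMap.mulLeft_apply, LinearMap.mulRight_apply, one_mul]

variable [IsModuleAlgebra H A]

theorem SmashProduct.tmul_mul_one_tmul (a : A) (h k : H) :
    toSmash A H (a ⊗ₜ h) * toSmash A H (1 ⊗ₜ k) = toSmash A H (a ⊗ₜ (h * k)) := by
  have hcounit : LinearMap.mulLeft ℂ a ∘ₗ (actionBilin H A).flip 1 =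
      LinearMap.toSpanSingleton ℂ A a ∘ₗ Coalgebra.counit := LinearMap.ext fun h => by
    simp [IsModuleAlgebra.smul_one, Algebra.smul_def, ← Algebra.commutes]
  rw [tmul_mul_tmul, hcounit, ← LinearMap.map_comp_rTensor, LinearMap.comp_apply,
    Coalgebra.rTensor_counit_comul, TensorProduct.map_tmul, LinearMap.toSpanSingleton_apply_one,
    LinearMap.mulRight_apply]

variable (A H) in
/-- The homomorphism `a ↦ a ⊗ 1` from the module algebra to the smash product. -/
def SmashProduct.includeLeft : A →ₐ[ℂ] SmashProduct A H :=
  AlgHom.ofLinearMap ((toSmash A H).toLinearMap ∘ₗ (TensorProduct.mk ℂ A H).flip 1) rfl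
    fun a b => (tmul_one_mul_tmul a b 1).symm

variable (A H) in
/-- The homomorphism `h ↦ 1 ⊗ h` from the bialgebra to the smash product. -/
def SmashProduct.includeRight : H →ₐ[ℂ] SmashProduct A H :=
  AlgHom.ofLinearMap ((toSmash A H).toLinearMap ∘ₗ TensorProduct.mk ℂ A H 1) rfl
    fun h k => (tmul_mul_one_tmul 1 h k).symm

theorem SmashProduct.includeLeft_mul_includeRight (a : A) (h : H) :
    includeLeft A H a * includeRight A H h = toSmash A H (a ⊗ₜ h) :=
  (tmul_mul_one_tmul a 1 h).trans (by rw [one_mul])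

theorem SmashProduct.includeRight_mul_includeLeft (a : A) (h : H) :
    includeRight A H h * includeLeft A H a =
      toSmash A H (LinearMap.rTensor H ((actionBilin H A).flip a) (Coalgebra.comul h)) := by
  refine (tmul_mul_tmul 1 a h 1).trans ?_
  rw [LinearMap.mulLeft_one, LinearMap.mulRight_one, LinearMap.id_comp]
  rfl

theorem SmashProduct.toSmash_rTensor_mul_one_tmul (f : H →ₗ[ℂ] A) (t : H ⊗[ℂ] H) (k : H) :
    toSmash A H (LinearMap.rTensor H f (t * 1 ⊗ₜ k)) =
      toSmash A H (LinearMap.rTensor H f t) * includeRight A H k := by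
  induction t using TensorProduct.induction_on with
  | zero => simp only [zero_mul, map_zero]
  | add t t' ht ht' => simp only [add_mul, map_add, ht, ht']
  | tmul h l =>
    rw [Algebra.TensorProduct.tmul_mul_tmul, mul_one, LinearMap.rTensor_tmul]
    exact (tmul_mul_one_tmul (f h) l k).symm

/-- The projective seminorm `p ⊗ q`, regarded as a seminorm on the smash product. -/
def smashSeminorm (p : Seminorm ℂ A) (q : Seminorm ℂ H) : Seminorm ℂ (SmashProduct A H) :=
  (projSeminorm p q).comp (toSmash A H).symm.toLinearMap

theorem smashSeminorm_mul_le {p : Seminorm ℂ A} {q : Seminorm ℂ H} (hp : p ∈ stableSeminorms H A)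
    (hq : IsSubmultiplicative q) (x : A ⊗[ℂ] H) (y : SmashProduct A H) :
    smashSeminorm p q (toSmash A H x * y) ≤
      projSeminorm p ((projSeminorm (opSeminorm p hp.1) q).comp Coalgebra.comul) x *
        smashSeminorm p q y := by
  refine bilin_le_projSeminorm_mul_projSeminorm (r := smashSeminorm p q)
    ((LinearMap.mul ℂ (SmashProduct A H)).compl₁₂ (toSmash A H).toLinearMap
      (toSmash A H).toLinearMap) (fun a h b k => ?_) x ((toSmash A H).symm y)
  have hmap (l m : H) : projSeminorm p q ((a * l • b) ⊗ₜ (m * k)) ≤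
      p a * p b * q k * (opSeminorm p hp.1 l * q m) :=
    calc projSeminorm p q ((a * l • b) ⊗ₜ (m * k))
        ≤ p (a * l • b) * q (m * k) := projSeminorm_tmul_le p q _ _
      _ ≤ (p a * (opSeminorm p hp.1 l * p b)) * (q m * q k) := by
          gcongr
          · exact (hp.2 a _).trans
              (mul_le_mul_of_nonneg_left (le_opBounds_sInf hp.1 l b) (apply_nonneg p a))
          · exact hq m k
      _ = p a * p b * q k * (opSeminorm p hp.1 l * q m) := by ring
  calc smashSeminorm p q (toSmash A H (a ⊗ₜ h) * toSmash A H (b ⊗ₜ k))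
      = (projSeminorm p q).comp (TensorProduct.map (LinearMap.mulLeft ℂ a ∘ₗ
          (actionBilin H A).flip b) (LinearMap.mulRight ℂ k)) (Coalgebra.comul h) :=
        congrArg (smashSeminorm p q) (SmashProduct.tmul_mul_tmul a b h k)
    _ ≤ p a * p b * q k * projSeminorm (opSeminorm p hp.1) q (Coalgebra.comul h) :=
        le_projSeminorm _ _ _ (by positivity) hmap _
    _ = p a * projSeminorm (opSeminorm p hp.1) q (Coalgebra.comul h) * (p b * q k) := by ring

theorem exists_submult_smashSeminorm_le {p : Seminorm ℂ A} {q : Seminorm ℂ H}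
    (hp : p ∈ stableSeminorms H A) (hq : IsSubmultiplicative q) :
    ∃ s ∈ submultSeminorms (SmashProduct A H), ∃ C : ℝ≥0, ∀ x, smashSeminorm p q x ≤ C * s x :=
  IsStable.exists_submult_le <| .of_bound fun x =>
    ⟨_, smashSeminorm_mul_le hp hq ((toSmash A H).symm x)⟩

theorem exists_submult_comp_smashToAnalytic_le {r : Seminorm ℂ (AnalyticSmash A H)}
    (hr : Continuous r) :
    ∃ s ∈ submultSeminorms (SmashProduct A H), ∃ C : ℝ≥0, ∀ x,
      r (smashToAnalyticLinear A H x) ≤ C * s x := by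
  obtain ⟨p, hp, q, hq, hpq⟩ := exists_comp_jmap_le (isDominating_stableSeminorms H A)
    isDominating_submultSeminorms hr
  obtain ⟨s, hs, C, hC⟩ := exists_submult_smashSeminorm_le hp hq
  exact ⟨s, hs, C, fun x => (hpq ((toSmash A H).symm x)).trans (hC x)⟩

instance : UniformContinuousConstSMul ℂ (AnalyticSmash A H) :=
  uniformContinuousConstSMul_of_continuousConstSMul _ _

variable (A H) in
/-- The continuous linear extension `(A # H)^ → Ã #̂ Ĥ` of the canonical map. -/
def envelopeToAnalytic : AMEnvelope (SmashProduct A H) →L[ℂ] AnalyticSmash A H :=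
  SeminormCompletion.lift (smashToAnalyticLinear A H)
    fun _ => exists_submult_comp_smashToAnalytic_le

theorem envelopeToAnalytic_toAMEnvelope (x : SmashProduct A H) :
    envelopeToAnalytic A H (toAMEnvelope _ x) = smashToAnalytic A H x :=
  SeminormCompletion.lift_embed _ (fun _ => exists_submult_comp_smashToAnalytic_le) x

end Bialgebra

section HopfAlgebra

variable [HopfAlgebra ℂ H] [IsScalarTower ℂ H A] [IsModuleAlgebra H A]

theorem SmashProduct.includeLeft_smul {ι : Type*} {h : H} (r : Coalgebra.Repr ℂ h ι) (a : A) :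
    includeLeft A H (h • a) =
      ∑ i ∈ r.index, includeRight A H (r.left i) * includeLeft A H a *
        includeRight A H (HopfAlgebraStruct.antipode ℂ (r.right i)) := by
  simp only [includeRight_mul_includeLeft, ← toSmash_rTensor_mul_one_tmul, ← map_sum,
    sum_comul_mul_antipode]
  rfl

theorem IsSubmultiplicative.comp_includeLeft_mem_stableSeminorms
    {r : Seminorm ℂ (SmashProduct A H)} (hr : IsSubmultiplicative r) :
    r.comp (SmashProduct.includeLeft A H).toLinearMap ∈ stableSeminorms H A := by
  refine ⟨.of_bound fun h => ?_, hr.comp_algHom _⟩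
  exact ⟨_, fun a =>
    (congrArg r (SmashProduct.includeLeft_smul (Coalgebra.Repr.arbitrary ℂ h) a)).trans_le
      (hr.sum_mul_mul_le _ _ _ _)⟩

theorem exists_toAMEnvelope_tmul_le {r : Seminorm ℂ (AMEnvelope (SmashProduct A H))}
    (hr : Continuous r) :
    ∃ p ∈ stableSeminorms H A, ∃ q ∈ submultSeminorms H, ∀ a h,
      r (toAMEnvelope _ (toSmash A H (a ⊗ₜ h))) ≤ p a * q h := by
  obtain ⟨s, hs, hrs⟩ := exists_submult_le hr
  refine ⟨_, IsSubmultiplicative.comp_includeLeft_mem_stableSeminorms hs,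
    _, IsSubmultiplicative.comp_algHom hs (SmashProduct.includeRight A H), fun a h => ?_⟩
  rw [← SmashProduct.includeLeft_mul_includeRight]
  exact (hrs _).trans (hs _ _)

variable (A H) in
/-- The continuous linear map `Ã #̂ Ĥ → (A # H)^` induced by the bilinear map `(a, h) ↦ a ⊗ h`. -/
def analyticToEnvelope : AnalyticSmash A H →L[ℂ] AMEnvelope (SmashProduct A H) :=
  CProj.liftOfBound (((TensorProduct.mk ℂ A H).compr₂ (toSmash A H).toLinearMap).compr₂
    (toAMEnvelope (SmashProduct A H)).toLinearMap) fun _ => exists_toAMEnvelope_tmul_le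

theorem analyticToEnvelope_smashToAnalytic (x : SmashProduct A H) :
    analyticToEnvelope A H (smashToAnalytic A H x) = toAMEnvelope _ x := by
  refine (CProj.liftOfBound_jmap _ (fun _ => exists_toAMEnvelope_tmul_le)
    ((toSmash A H).symm x)).trans ?_
  rw [TensorProduct.lift_compr₂, TensorProduct.lift_compr₂, TensorProduct.lift_mk]
  rfl

end HopfAlgebra

end SmashProduct

end ArensMichael

end

theorem theorem3p1 {H A : Type*} [Ring H] [HopfAlgebra ℂ H] [Ring A] [Algebra ℂ A] [Module H A]
    [IsScalarTower ℂ H A] [ArensMichael.IsModuleAlgebra H A] :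
    ∃ Φ : ArensMichael.AMEnvelope (ArensMichael.SmashProduct A H) ≃A[ℂ]
        ArensMichael.AnalyticSmash A H,
      ∀ x : ArensMichael.SmashProduct A H,
        Φ (ArensMichael.toAMEnvelope (ArensMichael.SmashProduct A H) x) =
          ArensMichael.smashToAnalytic A H x :=
  ⟨ArensMichael.continuousAlgEquivOfDenseRange
      (ArensMichael.denseRange_toSeminormCompletion _)
      (ArensMichael.denseRange_smashToAnalyticLinear A H)
      (ArensMichael.envelopeToAnalytic A H) (ArensMichael.analyticToEnvelope A H)
      ArensMichael.envelopeToAnalytic_toAMEnvelope ArensMichael.analyticToEnvelope_smashToAnalytic,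
    ArensMichael.envelopeToAnalytic_toAMEnvelope⟩
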